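/- **Setting.** Let $n,m\ge 1$, let $\mathcal X\subset\mathbb R^n$ and $\mathcal Y\subset\mathbb R^m$ be compact convex sets with $\mathrm{span}(\mathcal X)=\mathbb R^n$, $\mathrm{span}(\mathcal Y)=\mathbb R^m$, and let $A\in\mathbb R^{n\times m}$ satisfy $\langle x,Ay\rangle\in[-1,1]$ for all $x\in\mathcal X$, $y\in\mathcal Y$. In round $k=1,2,\dots$ the players choose $x_k\in\mathcal X$ and $y_k\in\mathcal Y$; the row player observes only $\langle x_k,Ay_k\rangle$ and the column player only $-\langle x_k,Ay_k\rangle$. A pair $(\tilde x,\tilde y)\in\mathcal X\times\mathcal Y$ is an $\varepsilon$-approximate Nash equilibrium if $\langle x,A\tilde y\rangle-\varepsilon\le\langle\tilde x,A\tilde y\rangle\le\langle\tilde x,Ay\rangle+\varepsilon$ for all $(x,y)\in\mathcal X\times\mathcal Y$. **Algorithm (row player).** Inputs: $\delta\in(0,\frac12]$; a step size $\eta>0$; points $p_1,\dots,p_n\in\mathcal X$ with $V=\frac1n\sum_i p_ip_i^\top\succ0$ and $x^\top V^{-1}x\le 2n^2$ for all $x\in\mathcal X$; a matrix $H\succ0$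 such that $E=\{x:x^\top Hx\le1\}$ satisfies $E\subseteq\mathrm{conv}(\mathcal X\cup-\mathcal X)\subseteq\sqrt{n(n+1)}\,E$. Put $\phi(x)=\frac12x^\top Hx$, $L_t=\log(8t^2/\delta)$, $B_t=\lceil t^3L_t\rceil$, $\lambda_t=t^{-2}$, $\hat\theta_0=0$, $\tilde x_1=\frac1n\sum_ip_i$. Phase $t=1,2,\dots$ consists of $B_t$ rounds. Let $\bar x_t=\frac1t\sum_{\ell\le t}\tilde x_\ell$. In each round $s=1,\dots,B_t$ of phase $t$, with fresh independent randomness, play $x_{t,s}=\bar x_t$ with probability $\frac12$ (an unperturbed round) and otherwise $x_{t,s}=(1-\lambda_t)\bar x_t+\lambda_tp_i$ with $i$ uniform on $\{1,\dots,n\}$ (an exploring round of $p_i$), and observe the reward $r_{t,s}$. After phase $t$, if $B_t\ge 32n^2L_t$, at least $B_t/4$ rounds of the phase were unperturbed, and each $p_i$ was explored in at least $B_t/(4n)$ rounds, let $q=\lfloor B_t/(4n)\rfloor$, match the first $q$ exploring rounds of each of $p_1,\dots,p_n$ (taken in this order) with the first $nq$ unperturbed rounds, and set $$\hat\theta_t=\Big(\sum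 zz^\top\Big)^{-1}\sum\frac{r_{t,s'}-(1-\lambda_t)r_{t,s}}{\lambda_t}\,z,$$ where the sums run over the matched pairs of an unperturbed round $s$ and an exploring round $s'$, and $z$ is the point explored in round $s'$; otherwise set $\hat\theta_t=0$. Then put $\hat u_t=t\hat\theta_t-(t-1)\hat\theta_{t-1}$ and $$\tilde x_{t+1}=\arg\max_{x\in\mathcal X}\Big\{\Big\langle x,\sum_{\ell=1}^t\hat u_\ell+\hat u_t\Big\rangle-\tfrac1\eta\phi(x)\Big\}.$$ The column player runs the same algorithm with the same $\delta$ and $\eta$, its own set $\mathcal Y$, its own rewards, independent randomness, and analogous inputs for $\mathcal Y$ (dimension $m$). The rounds of all phases are numbered consecutively by $k=1,2,\dots$. **Theorem.** There is a universal constant $C>0$ such that, for all data as above, if both players run the algorithm with $\eta=\frac16$, then with probability at least $1-\delta$, for every $k\ge1$ the iterate $(x_k,y_k)$ is an $\varepsilon_k$-approximate Nash equilibrium, where $$\varepsilon_k=C\,(n^3+m^3)\,\log(k+1)\,\log^{1/4}\!\big(8k^2/\delta\big)\,k^{-1/4}.$$ -/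

import Mathlib

open scoped Matrix Pointwise
open MeasureTheory ProbabilityTheory

noncomputable section

namespace BanditGame

/-- The bilinear payoff `⟨x, A y⟩` of the row player (the column player receives its negative). -/
def payoff {n m : ℕ} (A : Matrix (Fin n) (Fin m) ℝ) (x : Fin n → ℝ) (y : Fin m → ℝ) : ℝ :=
  x ⬝ᵥ (A *ᵥ y)

/-- `(x₀, y₀) ∈ X × Y` is an `ε`-approximate Nash equilibrium of the zero-sum game:
`⟨x, A y₀⟩ - ε ≤ ⟨x₀, A y₀⟩ ≤ ⟨x₀, A y⟩ + ε` for all `(x, y) ∈ X × Y`. -/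
def IsApproxNash {n m : ℕ} (X : Set (Fin n → ℝ)) (Y : Set (Fin m → ℝ))
    (A : Matrix (Fin n) (Fin m) ℝ) (ε : ℝ) (x₀ : Fin n → ℝ) (y₀ : Fin m → ℝ) : Prop :=
  x₀ ∈ X ∧ y₀ ∈ Y ∧ ∀ x ∈ X, ∀ y ∈ Y,
    payoff A x y₀ - ε ≤ payoff A x₀ y₀ ∧ payoff A x₀ y₀ ≤ payoff A x₀ y + ε

/-- The design matrix `V = (1/d) ∑ᵢ pᵢ pᵢᵀ`. -/
def designMatrix {d : ℕ} (p : Fin d → Fin d → ℝ) : Matrix (Fin d) (Fin d) ℝ :=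
  (1 / (d : ℝ)) • ∑ i, Matrix.vecMulVec (p i) (p i)

/-- The points `p₁, …, p_d ∈ X` support an admissible exploration distribution (uniform on them):
`V ≻ 0` and `xᵀ V⁻¹ x ≤ 2 d²` on `X`. -/
def IsExplorationDesign {d : ℕ} (X : Set (Fin d → ℝ)) (p : Fin d → Fin d → ℝ) : Prop :=
  (∀ i, p i ∈ X) ∧ (designMatrix p).PosDef ∧
    ∀ x ∈ X, x ⬝ᵥ ((designMatrix p)⁻¹ *ᵥ x) ≤ 2 * (d : ℝ) ^ 2

/-- The ellipsoid `{x : xᵀ H x ≤ 1}`. -/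
def ellipsoid {d : ℕ} (H : Matrix (Fin d) (Fin d) ℝ) : Set (Fin d → ℝ) :=
  {x | x ⬝ᵥ (H *ᵥ x) ≤ 1}

/-- `H ≻ 0` and `E ⊆ K ⊆ √(d(d+1)) E` for the ellipsoid `E` of `H` and
`K = conv (X ∪ -X)`. -/
def IsEllipsoidApprox {d : ℕ} (X : Set (Fin d → ℝ)) (H : Matrix (Fin d) (Fin d) ℝ) : Prop :=
  H.PosDef ∧ ellipsoid H ⊆ convexHull ℝ (X ∪ -X) ∧
    convexHull ℝ (X ∪ -X) ⊆ Real.sqrt ((d : ℝ) * ((d : ℝ) + 1)) • ellipsoid H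

/-- The number of rounds of phase `t`: `t³ log (8 t² / δ)`, rounded up. -/
def batch (δ : ℝ) (t : ℕ) : ℕ := ⌈Real.log (8 * (t : ℝ) ^ 2 / δ) * (t : ℝ) ^ 3⌉₊

/-- The mixing parameter `λ_t = t⁻²`. -/
def mixing (t : ℕ) : ℝ := 1 / (t : ℝ) ^ 2

/-- The private randomness that a player uses in one round: a coin (`true` means explore) and the
index of a support point of the exploration distribution. The index is ignored if the coin shows
`false`. -/
abbrev Coin (d : ℕ) := Bool × Fin d

/-- A maximizer of `f` on `X`. -/
def argmaxOn {d : ℕ} (X : Set (Fin d → ℝ)) (f : (Fin d → ℝ) → ℝ) : Fin d → ℝ :=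
  Classical.epsilon fun x => x ∈ X ∧ IsMaxOn f X x

/-- The `j`-th (from `j = 0`) round `s ∈ {1, …, B}` of a phase in which the player used the
unperturbed strategy. -/
def baseRound {d : ℕ} (B : ℕ) (c : ℕ → Coin d) (j : ℕ) : ℕ :=
  Nat.nth (fun s => s ∈ Finset.Icc 1 B ∧ (c s).1 = false) j

/-- The `j`-th (from `j = 0`) round `s ∈ {1, …, B}` of a phase in which the player explored with
the support point number `i`. -/
def exploreRound {d : ℕ} (B : ℕ) (c : ℕ → Coin d) (i : Fin d) (j : ℕ) : ℕ :=
  Nat.nth (fun s => s ∈ Finset.Icc 1 B ∧ c s = (true, i)) j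

/-- The phase has enough rounds, at least `B/4` of them are unperturbed, and each of the `d` support
points was explored in at least `B/(4d)` of them. -/
def EnoughSamples {d : ℕ} (δ : ℝ) (t : ℕ) (c : ℕ → Coin d) : Prop :=
  32 * (d : ℝ) ^ 2 * Real.log (8 * (t : ℝ) ^ 2 / δ) ≤ (batch δ t : ℝ) ∧
  (batch δ t : ℝ) / 4 ≤
    (((Finset.Icc 1 (batch δ t)).filter fun s => (c s).1 = false).card : ℝ) ∧
  ∀ i : Fin d, (batch δ t : ℝ) / (4 * (d : ℝ)) ≤
    (((Finset.Icc 1 (batch δ t)).filter fun s => c s = (true, i)).card : ℝ)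

/-- The transformed reward `(r_{s'} - (1 - λ_t) r_s) / λ_t` of a pair of an unperturbed round `s`
and an exploring round `s'`. -/
def transformedReward (t : ℕ) (r : ℕ → ℝ) (s s' : ℕ) : ℝ :=
  (r s' - (1 - mixing t) * r s) / mixing t

open Classical in
/-- The least-squares estimate computed after phase `t` from the player's own coins `c` and observed
rewards `r` of that phase. With `q = ⌊B_t/(4d)⌋`, the first `q` exploring rounds of each support
point `pᵢ` are paired with the first `d q` unperturbed rounds, and
`θ̂ = (∑ z zᵀ)⁻¹ ∑ r̂ z` over all pairs. Without enough samples, the estimate is `0`. -/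
def estimate {d : ℕ} (p : Fin d → Fin d → ℝ) (δ : ℝ) (t : ℕ) (c : ℕ → Coin d) (r : ℕ → ℝ) :
    Fin d → ℝ :=
  let q : ℕ := batch δ t / (4 * d)
  if EnoughSamples δ t c then
    (∑ i : Fin d, ∑ _j : Fin q, Matrix.vecMulVec (p i) (p i))⁻¹ *ᵥ
      ∑ i : Fin d, ∑ j : Fin q,
        transformedReward t r (baseRound (batch δ t) c ((i : ℕ) * q + (j : ℕ)))
          (exploreRound (batch δ t) c i (j : ℕ)) • p i
  else 0

/-- The inputs of one player's algorithm: own action set, support of the exploration distribution,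
matrix of the quadratic regularizer, step size, error probability. -/
structure Learner (d : ℕ) where
  X : Set (Fin d → ℝ)
  p : Fin d → Fin d → ℝ
  H : Matrix (Fin d) (Fin d) ℝ
  η : ℝ
  δ : ℝ

namespace Learner

variable {d : ℕ} (P : Learner d)

/-- The regularizer `φ(x) = ½ xᵀ H x`. -/
def regularizer (x : Fin d → ℝ) : ℝ := 1 / 2 * (x ⬝ᵥ (P.H *ᵥ x))

/-- The mean of the exploration distribution. -/
def explorationMean : Fin d → ℝ := (1 / (d : ℝ)) • ∑ i, P.p i

/-! Below, `c t s` is the player's own coin and `r t s` the player's own reward in round `s` of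
phase `t` (phases and rounds are numbered from `1`). -/

/-- The estimate `θ̂_t` after phase `t`, with `θ̂_0 = 0`. -/
def thetaHat (c : ℕ → ℕ → Coin d) (r : ℕ → ℕ → ℝ) : ℕ → (Fin d → ℝ)
  | 0 => 0
  | t + 1 => estimate P.p P.δ (t + 1) (c (t + 1)) (r (t + 1))

/-- The estimated phase utility `û_t = t θ̂_t - (t - 1) θ̂_{t-1}`. -/
def utilityHat (c : ℕ → ℕ → Coin d) (r : ℕ → ℕ → ℝ) (t : ℕ) : Fin d → ℝ :=
  (t : ℝ) • P.thetaHat c r t - ((t : ℝ) - 1) • P.thetaHat c r (t - 1)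

/-- The OFTRL outputs: `x̃_1` is the exploration mean, and `x̃_{t+1}` maximizes
`⟨x, ∑_{ℓ ≤ t} û_ℓ + û_t⟩ - φ(x)/η` over the action set. The value at `0` is not used. -/
def oftrl (c : ℕ → ℕ → Coin d) (r : ℕ → ℕ → ℝ) : ℕ → (Fin d → ℝ)
  | 0 => P.explorationMean
  | 1 => P.explorationMean
  | t + 2 => argmaxOn P.X fun x =>
      x ⬝ᵥ (∑ l ∈ Finset.Icc 1 (t + 1), P.utilityHat c r l + P.utilityHat c r (t + 1))
        - 1 / P.η * P.regularizer x

/-- The running average `x̄_t = (1/t) ∑_{ℓ ≤ t} x̃_ℓ`. -/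
def average (c : ℕ → ℕ → Coin d) (r : ℕ → ℕ → ℝ) (t : ℕ) : Fin d → ℝ :=
  (1 / (t : ℝ)) • ∑ l ∈ Finset.Icc 1 t, P.oftrl c r l

/-- The strategy played in round `s` of phase `t`: `x̄_t` if the coin shows `false`, and
`(1 - λ_t) x̄_t + λ_t pᵢ` if it shows `(true, i)`. -/
def play (c : ℕ → ℕ → Coin d) (r : ℕ → ℕ → ℝ) (t s : ℕ) : Fin d → ℝ :=
  if (c t s).1 = true then
    (1 - mixing t) • P.average c r t + mixing t • P.p (c t s).2
  else P.average c r t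

theorem thetaHat_congr (c : ℕ → ℕ → Coin d) {r r' : ℕ → ℕ → ℝ} {t : ℕ} (h : r t = r' t) :
    P.thetaHat c r t = P.thetaHat c r' t := by
  cases t with
  | zero => rw [thetaHat, thetaHat]
  | succ t => rw [thetaHat, thetaHat, h]

theorem utilityHat_congr (c : ℕ → ℕ → Coin d) {r r' : ℕ → ℕ → ℝ} {t : ℕ}
    (h : ∀ l ≤ t, r l = r' l) : P.utilityHat c r t = P.utilityHat c r' t := by
  rw [utilityHat, utilityHat, P.thetaHat_congr c (h t le_rfl),
    P.thetaHat_congr c (h (t - 1) (Nat.sub_le t 1))]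

theorem oftrl_congr (c : ℕ → ℕ → Coin d) {r r' : ℕ → ℕ → ℝ} {t : ℕ}
    (h : ∀ l < t, r l = r' l) : P.oftrl c r t = P.oftrl c r' t := by
  rcases t with _ | _ | t
  · rw [oftrl, oftrl]
  · rw [oftrl, oftrl]
  · have hs : ∑ l ∈ Finset.Icc 1 (t + 1), P.utilityHat c r l
        = ∑ l ∈ Finset.Icc 1 (t + 1), P.utilityHat c r' l :=
      Finset.sum_congr rfl fun l hl => P.utilityHat_congr c fun j hj =>
        h j (by have := (Finset.mem_Icc.mp hl).2; omega)
    have hu : P.utilityHat c r (t + 1) = P.utilityHat c r' (t + 1) :=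
      P.utilityHat_congr c fun j hj => h j (by omega)
    rw [oftrl, oftrl, hs, hu]

/-- The strategies of phase `t` depend on the rewards of the earlier phases only. -/
theorem play_congr (c : ℕ → ℕ → Coin d) {r r' : ℕ → ℕ → ℝ} {t : ℕ}
    (h : ∀ l < t, r l = r' l) (s : ℕ) : P.play c r t s = P.play c r' t s := by
  have ha : P.average c r t = P.average c r' t := by
    rw [average, average, Finset.sum_congr rfl fun l hl => P.oftrl_congr c fun j hj =>
      h j (by have := (Finset.mem_Icc.mp hl).2; omega)]
  rw [play, play, ha]

end Learner

section Interaction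

variable {n m : ℕ} (P : Learner n) (Q : Learner m) (A : Matrix (Fin n) (Fin m) ℝ)
  (c : ℕ → ℕ → Coin n) (e : ℕ → ℕ → Coin m)

/-- The reward `⟨x_{t,s}, A y_{t,s}⟩` that the row player observes in round `s` of phase `t` when
the learners `P` (with coins `c`) and `Q` (with coins `e`) play against each other; the column
player observes its negative. Each strategy is computed from that player's own coins and own
earlier rewards. -/
def reward (t : ℕ) : ℕ → ℝ := fun s =>
  payoff A
    (P.play c (fun l => if _h : l < t then reward l else 0) t s)
    (Q.play e (fun l => if _h : l < t then -reward l else 0) t s)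
termination_by t

/-- The strategy of the row player in round `s` of phase `t`. -/
def rowPlay (t s : ℕ) : Fin n → ℝ := P.play c (reward P Q A c e) t s

/-- The strategy of the column player in round `s` of phase `t`. -/
def colPlay (t s : ℕ) : Fin m → ℝ := Q.play e (-reward P Q A c e) t s

theorem reward_eq (t s : ℕ) :
    reward P Q A c e t s = payoff A (rowPlay P Q A c e t s) (colPlay P Q A c e t s) := by
  have hx : ∀ l < t, (fun l => if _h : l < t then reward P Q A c e l else 0) l
      = reward P Q A c e l := fun l hl => by simp only [dif_pos hl]
  have hy : ∀ l < t, (fun l => if _h : l < t then -reward P Q A c e l else 0) l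
      = (-reward P Q A c e) l := fun l hl => by simp only [dif_pos hl, Pi.neg_apply]
  rw [reward, rowPlay, colPlay, P.play_congr c hx s, Q.play_congr e hy s]

end Interaction

/-- The phase to which the `k`-th round overall belongs (`k ≥ 1`): the least `t` with
`k ≤ B_1 + ⋯ + B_t`. -/
def phaseOf (δ : ℝ) (k : ℕ) : ℕ := sInf {t | k ≤ ∑ l ∈ Finset.Icc 1 t, batch δ l}

/-- The number, within its phase, of the `k`-th round overall. -/
def roundOf (δ : ℝ) (k : ℕ) : ℕ := k - ∑ l ∈ Finset.Icc 1 (phaseOf δ k - 1), batch δ l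

/-- The strategy `x_k` of the row player in the `k`-th round overall. -/
def rowIterate {n m : ℕ} (P : Learner n) (Q : Learner m) (A : Matrix (Fin n) (Fin m) ℝ)
    (c : ℕ → ℕ → Coin n) (e : ℕ → ℕ → Coin m) (k : ℕ) : Fin n → ℝ :=
  rowPlay P Q A c e (phaseOf P.δ k) (roundOf P.δ k)

/-- The strategy `y_k` of the column player in the `k`-th round overall. -/
def colIterate {n m : ℕ} (P : Learner n) (Q : Learner m) (A : Matrix (Fin n) (Fin m) ℝ)
    (c : ℕ → ℕ → Coin n) (e : ℕ → ℕ → Coin m) (k : ℕ) : Fin m → ℝ :=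
  colPlay P Q A c e (phaseOf Q.δ k) (roundOf Q.δ k)

/-- The coins of both players are fair: in every round, each player's coin is uniform on
`Bool × Fin d`, the coins of the two players are independent, and different rounds are
independent. -/
structure FairCoins {Ω : Type*} [MeasurableSpace Ω] (μ : Measure Ω) {n m : ℕ}
    (c : ℕ → ℕ → Ω → Coin n) (e : ℕ → ℕ → Ω → Coin m) : Prop where
  measurable_row : ∀ t s, Measurable (c t s)
  measurable_col : ∀ t s, Measurable (e t s)
  law_row : ∀ t s v, μ {ω | c t s ω = v} = (2 * (n : ENNReal))⁻¹
  law_col : ∀ t s v, μ {ω | e t s ω = v} = (2 * (m : ENNReal))⁻¹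
  indep_players : ∀ t s, IndepFun (c t s) (e t s) μ
  indep_rounds : iIndepFun (fun (i : ℕ × ℕ) ω => (c i.1 i.2 ω, e i.1 i.2 ω)) μ

/-- The rate `C (n³ + m³) log (k + 1) log (8 k² / δ)^{1/4} k^{-1/4}`. -/
def rate (C : ℝ) (n m : ℕ) (δ : ℝ) (k : ℕ) : ℝ :=
  C * ((n : ℝ) ^ 3 + (m : ℝ) ^ 3) * Real.log ((k : ℝ) + 1)
    * Real.log (8 * (k : ℝ) ^ 2 / δ) ^ (1 / 4 : ℝ) * (k : ℝ) ^ (-(1 / 4) : ℝ)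

end BanditGame

end

/-! In phase `t` each player plays the average of its OFTRL outputs up to a perturbation of size
`λ_t = t⁻²`. Hence every round of the phase is an approximate equilibrium once the pair of averages
has a small duality gap, and `t` times this gap is the sum of the two regrets of the OFTRL outputs.

Regret. Put `ε_t = t (θ̂_t - A ȳ_t)`. Since `t ȳ_t - (t - 1) ȳ_{t-1} = ỹ_t`, the fed utility is `û_t
= A ỹ_t + ε_t - ε_{t-1}`: the errors telescope, so they never accumulate in the sum that OFTRL sees.
They enter the regret only through the last two phases and through `∑ ‖ε_t‖²` (`optimistic_regret`,
`player_regret`). The game matrix has norm at most one in the norms of the two ellipsoids, so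
optimism bounds each regret by half the squared movement of the opponent minus twice the player's
own. These terms cancel on adding the two players. If the error of `θ̂_t` on the action set is
`O(√(n³/t³))`, then `‖ε_t‖² = O(n³/t)`, the regrets are `O((n³ + m³) log t)`, and the gap is this
divided by `t` (`isApproxNash_of_error`).

Estimation. In `r_{s'} - (1 - λ_t) r_s` the common value `⟨x̄_t, A ȳ_t⟩` cancels. The opponent's own
perturbation also has size `λ_t`, so division by `λ_t` leaves `⟨p_i, A ȳ_t⟩` plus bounded noise
whose mean is only `O(λ_t)` (`estimate_error`). Given the past and the player's own coins of the
phase, the averages and the matched rounds are fixed while the opponent's coins remain independent,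
so Hoeffding's inequality applies on each fibre (`measure_le_of_fiber`, `measure_error_le`). The
design bound turns this into an error bound on the whole action set (`least_squares_error`).

Rate. Phases of length about `t³ log(8 t² / δ)` put round `k` in a phase of order at least `(k /
log(8 k² / δ))^{1/4}`. A union bound over phases and players finishes the proof. -/

noncomputable section

namespace BanditGame

/-! ### Duality between the action sets and the ellipsoid norms -/

section QuadraticForm

variable {d : ℕ}

/-- The square of the norm of the ellipsoid of `H`. -/
def quadForm (H : Matrix (Fin d) (Fin d) ℝ) (v : Fin d → ℝ) : ℝ := v ⬝ᵥ (H *ᵥ v)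

theorem quadForm_nonneg {H : Matrix (Fin d) (Fin d) ℝ} (hH : H.PosDef) (v : Fin d → ℝ) :
    0 ≤ quadForm H v := by
  have := hH.posSemidef.dotProduct_mulVec_nonneg v
  simpa [quadForm] using this

theorem quadForm_pos {H : Matrix (Fin d) (Fin d) ℝ} (hH : H.PosDef) {v : Fin d → ℝ}
    (hv : v ≠ 0) : 0 < quadForm H v := by
  have := hH.dotProduct_mulVec_pos hv
  simpa [quadForm] using this

theorem quadForm_smul (H : Matrix (Fin d) (Fin d) ℝ) (a : ℝ) (v : Fin d → ℝ) :
    quadForm H (a • v) = a ^ 2 * quadForm H v := by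
  simp [quadForm, Matrix.mulVec_smul]; ring

theorem quadForm_sub_le {H : Matrix (Fin d) (Fin d) ℝ} (hH : H.PosDef) (v w : Fin d → ℝ) :
    quadForm H (v - w) ≤ 2 * quadForm H v + 2 * quadForm H w := by
  have := quadForm_nonneg hH (v + w)
  simp only [quadForm, Matrix.mulVec_add, Matrix.mulVec_sub, dotProduct_add, dotProduct_sub,
    add_dotProduct, sub_dotProduct] at *
  linarith

theorem continuous_quadForm (H : Matrix (Fin d) (Fin d) ℝ) : Continuous (quadForm H) := by
  unfold quadForm dotProduct Matrix.mulVec dotProduct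
  fun_prop

/-- The points where a linear functional has absolute value at most `κ` form a convex set that is
symmetric about the origin. -/
theorem abs_dotProduct_le_of_mem_hull {X : Set (Fin d → ℝ)} {u : Fin d → ℝ} {κ : ℝ}
    (hu : ∀ x ∈ X, |x ⬝ᵥ u| ≤ κ) {x : Fin d → ℝ} (hx : x ∈ convexHull ℝ (X ∪ -X)) :
    |x ⬝ᵥ u| ≤ κ := by
  have hconv : Convex ℝ {z : Fin d → ℝ | |z ⬝ᵥ u| ≤ κ} := by
    intro a ha b hb s t hs ht hst
    simp only [Set.mem_ofPred_eq, add_dotProduct, smul_dotProduct, smul_eq_mul] at *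
    rw [abs_le] at *
    constructor <;> nlinarith
  refine convexHull_min ?_ hconv hx
  rintro z (hz | hz)
  · exact hu z hz
  · have := hu (-z) hz
    simpa using this

/-- A linear functional bounded by `κ` on `X` has dual norm at most `κ`. -/
theorem sq_dotProduct_le {X : Set (Fin d → ℝ)} {H : Matrix (Fin d) (Fin d) ℝ}
    (hH : IsEllipsoidApprox X H) {u : Fin d → ℝ} {κ : ℝ}
    (hu : ∀ x ∈ X, |x ⬝ᵥ u| ≤ κ) (v : Fin d → ℝ) :
    (v ⬝ᵥ u) ^ 2 ≤ κ ^ 2 * quadForm H v := by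
  rcases eq_or_ne v 0 with rfl | hv
  · simp [quadForm]
  have hpos := quadForm_pos hH.1 hv
  set a := Real.sqrt (quadForm H v) with ha
  have ha0 : 0 < a := Real.sqrt_pos.2 hpos
  have ha2 : a ^ 2 = quadForm H v := Real.sq_sqrt hpos.le
  -- Scaled to the boundary of the ellipsoid, `v` lies in the hull, where the functional is at most
  -- `κ`; homogeneity gives the rest.
  have hmem : a⁻¹ • v ∈ ellipsoid H := by
    have : quadForm H (a⁻¹ • v) ≤ 1 := by
      rw [quadForm_smul, ← ha2]; field_simp; exact le_rfl
    exact this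
  have h1 := abs_dotProduct_le_of_mem_hull hu (hH.2.1 hmem)
  rw [smul_dotProduct, smul_eq_mul, abs_mul, abs_of_pos (inv_pos.2 ha0),
    inv_mul_le_iff₀ ha0] at h1
  rw [← ha2, ← sq_abs, ← mul_pow]
  have := pow_le_pow_left₀ (abs_nonneg _) h1 2
  nlinarith

theorem quadForm_le_of_mem {X : Set (Fin d → ℝ)} {H : Matrix (Fin d) (Fin d) ℝ}
    (hH : IsEllipsoidApprox X H) {x : Fin d → ℝ} (hx : x ∈ X) :
    quadForm H x ≤ d * (d + 1) := by
  obtain ⟨z, hz, rfl⟩ := hH.2.2 (subset_convexHull ℝ _ (Or.inl hx))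
  have hz' : quadForm H z ≤ 1 := hz
  have h0 : (0 : ℝ) ≤ d * (d + 1) := by positivity
  change quadForm H (Real.sqrt ((d : ℝ) * ((d : ℝ) + 1)) • z) ≤ _
  rw [quadForm_smul, Real.sq_sqrt h0]
  nlinarith [quadForm_nonneg hH.1 z]

theorem quadForm_sub_le_of_mem {X : Set (Fin d → ℝ)} {H : Matrix (Fin d) (Fin d) ℝ}
    (hH : IsEllipsoidApprox X H) {x z : Fin d → ℝ} (hx : x ∈ X) (hz : z ∈ X) :
    quadForm H (x - z) ≤ 4 * (d * (d + 1)) := by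
  have := quadForm_sub_le hH.1 x z
  have := quadForm_le_of_mem hH hx
  have := quadForm_le_of_mem hH hz
  linarith

theorem payoff_neg_transpose {n m : ℕ} (A : Matrix (Fin n) (Fin m) ℝ) (x : Fin n → ℝ)
    (y : Fin m → ℝ) : payoff (-Aᵀ) y x = -payoff A x y := by
  rw [payoff, payoff, Matrix.neg_mulVec, dotProduct_neg, Matrix.mulVec_transpose,
    Matrix.dotProduct_mulVec, dotProduct_comm]

/-- The payoff has norm at most one with respect to the norms of the two ellipsoids. -/
theorem sq_payoff_le {n m : ℕ} {X : Set (Fin n → ℝ)} {Y : Set (Fin m → ℝ)}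
    {A : Matrix (Fin n) (Fin m) ℝ} (hA : ∀ x ∈ X, ∀ y ∈ Y, payoff A x y ∈ Set.Icc (-1 : ℝ) 1)
    {H : Matrix (Fin n) (Fin n) ℝ} (hH : IsEllipsoidApprox X H)
    {G : Matrix (Fin m) (Fin m) ℝ} (hG : IsEllipsoidApprox Y G)
    (v : Fin n → ℝ) (w : Fin m → ℝ) :
    payoff A v w ^ 2 ≤ quadForm H v * quadForm G w := by
  have hw := quadForm_nonneg hG.1 w
  -- Duality is used twice: for fixed `x ∈ X` the functional on the `Y` side is bounded by one,
  -- which bounds `A *ᵥ w` on `X` by the norm of `w`; this bound is the `κ` for `v`.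
  have key : ∀ x ∈ X, |x ⬝ᵥ (A *ᵥ w)| ≤ Real.sqrt (quadForm G w) := by
    intro x hx
    refine Real.abs_le_sqrt ?_
    have := sq_dotProduct_le hG (u := (-Aᵀ) *ᵥ x) (κ := 1) (fun y hy => ?_) w
    · change (payoff (-Aᵀ) w x) ^ 2 ≤ _ at this
      rw [payoff_neg_transpose] at this
      simpa [payoff] using this
    · change |payoff (-Aᵀ) y x| ≤ 1
      rw [payoff_neg_transpose, abs_neg]
      exact abs_le.2 (hA x hx y hy)
  have := sq_dotProduct_le hH key v
  rw [Real.sq_sqrt hw] at this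
  rw [mul_comm]; exact this

end QuadraticForm

/-! ### Optimistic FTRL with telescoping errors -/

section Optimistic

variable {d : ℕ}

/-- A maximizer over a convex set of a linear functional minus the quadratic `3 zᵀ H z`
beats every other point by the quadratic of the distance. -/
theorem quadratic_growth_of_isMaxOn {X : Set (Fin d → ℝ)} (hX : Convex ℝ X)
    {H : Matrix (Fin d) (Fin d) ℝ} (hH : H.PosDef) {w x : Fin d → ℝ} (hx : x ∈ X)
    (hmax : IsMaxOn (fun z => z ⬝ᵥ w - 3 * quadForm H z) X x) {z : Fin d → ℝ} (hz : z ∈ X) :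
    z ⬝ᵥ w - 3 * quadForm H z + 3 * quadForm H (z - x) ≤ x ⬝ᵥ w - 3 * quadForm H x := by
  -- First-order optimality: compare `x` with `x + s (z - x)` and divide by `s`. The left side is
  -- the directional derivative, to be shown nonpositive.
  have key : ∀ s : ℝ, 0 < s → s ≤ 1 →
      (z - x) ⬝ᵥ w - 3 * (x ⬝ᵥ H *ᵥ (z - x) + (z - x) ⬝ᵥ H *ᵥ x)
        ≤ s * (3 * quadForm H (z - x)) := by
    intro s hs hs1
    have hmem : (1 - s) • x + s • z ∈ X := hX hx hz (by linarith) hs.le (by ring)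
    have h := hmax hmem
    have heq : (1 - s) • x + s • z = x + s • (z - x) := by module
    rw [Set.mem_ofPred_eq, heq] at h
    simp only [quadForm] at *
    generalize z - x = v at *
    simp only [Matrix.mulVec_add, Matrix.mulVec_smul, dotProduct_add, add_dotProduct,
      smul_dotProduct, dotProduct_smul, smul_eq_mul] at h
    have : s * (v ⬝ᵥ w - 3 * (x ⬝ᵥ H *ᵥ v + v ⬝ᵥ H *ᵥ x) - s * (3 * (v ⬝ᵥ H *ᵥ v))) ≤ 0 := by
      linarith
    by_contra hcon
    push Not at hcon
    have : 0 < s * (v ⬝ᵥ w - 3 * (x ⬝ᵥ H *ᵥ v + v ⬝ᵥ H *ᵥ x) - s * (3 * (v ⬝ᵥ H *ᵥ v))) :=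
      mul_pos hs (by linarith)
    linarith
  have hle : (z - x) ⬝ᵥ w - 3 * (x ⬝ᵥ H *ᵥ (z - x) + (z - x) ⬝ᵥ H *ᵥ x) ≤ 0 := by
    by_contra hcon
    push Not at hcon
    set D := (z - x) ⬝ᵥ w - 3 * (x ⬝ᵥ H *ᵥ (z - x) + (z - x) ⬝ᵥ H *ᵥ x) with hD
    have hq := quadForm_nonneg hH (z - x)
    set Qv := 3 * quadForm H (z - x) with hQ
    -- This `s` replaces the limit `s → 0`: from `D ≤ s Qv` it gives `D² ≤ 0`.
    have := key (D / (D + Qv)) (by positivity) (by rw [div_le_one (by positivity)]; linarith)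
    rw [div_mul_eq_mul_div, le_div_iff₀ (by positivity)] at this
    nlinarith
  simp only [quadForm, Matrix.mulVec_sub, dotProduct_sub, sub_dotProduct] at *
  linarith

/-- Regret of optimistic follow-the-regularized-leader with regularizer `3 zᵀ H z` when the fed
utilities are `v t + ε t - ε (t - 1)`, measured against the utilities `v t`. -/
theorem optimistic_regret {X : Set (Fin d → ℝ)} (hX : Convex ℝ X)
    {H : Matrix (Fin d) (Fin d) ℝ} (hH : H.PosDef) {x u v ε : ℕ → Fin d → ℝ}
    (hx : ∀ t, x (t + 1) ∈ X) (hu0 : u 0 = 0) (hε0 : ε 0 = 0)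
    (hu : ∀ t, u (t + 1) = v (t + 1) + ε (t + 1) - ε t)
    (hmax : ∀ t, IsMaxOn (fun z => z ⬝ᵥ (∑ l ∈ Finset.range (t + 1), u (l + 1) + u (t + 1))
      - 3 * quadForm H z) X (x (t + 2)))
    (T : ℕ) {z : Fin d → ℝ} (hz : z ∈ X) :
    ∑ t ∈ Finset.range (T + 1), (z - x (t + 1)) ⬝ᵥ v (t + 1)
      ≤ 3 * quadForm H z + (x (T + 2) - z) ⬝ᵥ (u (T + 1) + ε (T + 1))
        + 3 * quadForm H (x 2 - x 1)
        + ∑ t ∈ Finset.range (T + 1), ((x (t + 2) - x (t + 1)) ⬝ᵥ (u (t + 1) - u t - ε (t + 1))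
          - 3 * quadForm H (x (t + 2) - x (t + 1))) := by
  have hsum : ∀ t, ∑ l ∈ Finset.range (t + 1), u (l + 1)
      = ∑ l ∈ Finset.range (t + 1), v (l + 1) + ε (t + 1) := by
    intro t
    induction t with
    | zero => simp [hu, hε0]
    | succ t ih => rw [Finset.sum_range_succ, ih, Finset.sum_range_succ _ (t + 1), hu]; abel
  -- Be-the-leader induction on the optimal value of the optimistic objective. Quadratic growth at
  -- each maximizer supplies the negative term for the next move.
  have main : ∀ T, x (T + 2) ⬝ᵥ (∑ l ∈ Finset.range (T + 1), u (l + 1) + u (T + 1))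
      - 3 * quadForm H (x (T + 2)) ≤ ∑ t ∈ Finset.range (T + 1), x (t + 1) ⬝ᵥ v (t + 1)
        + x (T + 2) ⬝ᵥ (u (T + 1) + ε (T + 1)) + 3 * quadForm H (x 2 - x 1)
        + ∑ t ∈ Finset.range (T + 1), ((x (t + 2) - x (t + 1)) ⬝ᵥ (u (t + 1) - u t - ε (t + 1))
          - 3 * quadForm H (x (t + 2) - x (t + 1))) := by
    intro T
    induction T with
    -- The point `x 1` maximizes nothing, so the first move has no growth term; `3 * quadForm H (x 2
    -- - x 1)` on the right compensates for it.
    | zero =>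
      have := quadForm_nonneg hH (x 2)
      simp [hu0, hε0, hu, sub_dotProduct, dotProduct_add, dotProduct_sub]
      linarith
    | succ T ih =>
      have hg := quadratic_growth_of_isMaxOn hX hH (hx (T + 1)) (hmax T) (hx (T + 2))
      rw [Finset.sum_range_succ _ (T + 1), Finset.sum_range_succ _ (T + 1),
        Finset.sum_range_succ (fun t => (x (t + 2) - x (t + 1)) ⬝ᵥ (u (t + 1) - u t - ε (t + 1))
          - 3 * quadForm H (x (t + 2) - x (t + 1))) (T + 1)]
      generalize ∑ l ∈ Finset.range (T + 1), u (l + 1) = S at *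
      generalize ∑ t ∈ Finset.range (T + 1), ((x (t + 2) - x (t + 1)) ⬝ᵥ
        (u (t + 1) - u t - ε (t + 1)) - 3 * quadForm H (x (t + 2) - x (t + 1))) = S' at *
      have e1 : x (T + 2) ⬝ᵥ u (T + 1 + 1) = x (T + 2) ⬝ᵥ (v (T + 1 + 1) + ε (T + 1 + 1) - ε (T + 1)) := by
        rw [hu]
      simp only [sub_dotProduct, dotProduct_add, dotProduct_sub] at *
      linarith
  have h1 := main T
  have h2 := hmax T hz
  rw [Set.mem_ofPred_eq] at h2
  have h3 : ∑ t ∈ Finset.range (T + 1), (z - x (t + 1)) ⬝ᵥ v (t + 1)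
      = z ⬝ᵥ ∑ t ∈ Finset.range (T + 1), v (t + 1)
        - ∑ t ∈ Finset.range (T + 1), x (t + 1) ⬝ᵥ v (t + 1) := by
    simp only [sub_dotProduct, Finset.sum_sub_distrib, dotProduct_sum]
  rw [h3]
  have h4 := congrArg (fun w => z ⬝ᵥ w) (hsum T)
  simp only [dotProduct_add, sub_dotProduct] at *
  linarith

end Optimistic

/-! ### Regret against an optimistic opponent -/

section Gap

variable {n m : ℕ} {X : Set (Fin n → ℝ)} {Y : Set (Fin m → ℝ)} {A : Matrix (Fin n) (Fin m) ℝ}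

/-- Regret of one optimistic learner, with the variation of its opponent and its own stability. -/
theorem player_regret (hX : Convex ℝ X)
    (hA : ∀ x ∈ X, ∀ y ∈ Y, payoff A x y ∈ Set.Icc (-1 : ℝ) 1)
    {H : Matrix (Fin n) (Fin n) ℝ} (hH : IsEllipsoidApprox X H)
    {G : Matrix (Fin m) (Fin m) ℝ} (hG : IsEllipsoidApprox Y G)
    {x u ε : ℕ → Fin n → ℝ} {y : ℕ → Fin m → ℝ} {κ : ℕ → ℝ}
    (hx : ∀ t, x (t + 1) ∈ X) (hy : ∀ t, y (t + 1) ∈ Y) (hu0 : u 0 = 0) (hε0 : ε 0 = 0)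
    (hu : ∀ t, u (t + 1) = A *ᵥ y (t + 1) + ε (t + 1) - ε t)
    (hmax : ∀ t, IsMaxOn (fun z => z ⬝ᵥ (∑ l ∈ Finset.range (t + 1), u (l + 1) + u (t + 1))
      - 3 * quadForm H z) X (x (t + 2)))
    (hκ : ∀ t, ∀ z ∈ X, |z ⬝ᵥ ε t| ≤ κ t) (T : ℕ) {z : Fin n → ℝ} (hz : z ∈ X) :
    ∑ t ∈ Finset.range (T + 1), payoff A (z - x (t + 1)) (y (t + 1))
      ≤ 15 * (n * (n + 1)) + 4 + 4 * κ (T + 1) + 2 * κ T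
        + 5 * ∑ t ∈ Finset.range (T + 1), κ t ^ 2
        - 2 * ∑ t ∈ Finset.range (T + 1), quadForm H (x (t + 2) - x (t + 1))
        + 1 / 2 * ∑ t ∈ Finset.range (T + 1), quadForm G (y (t + 2) - y (t + 1)) := by
  have hreg := optimistic_regret hX hH.1 (v := fun t => A *ᵥ y t) hx hu0 hε0 hu hmax T hz
  have hzq := quadForm_le_of_mem hH hz
  have hxq := quadForm_sub_le_of_mem hH (hx 1) (hx 0)
  have hend : (x (T + 2) - z) ⬝ᵥ (u (T + 1) + ε (T + 1)) ≤ 2 + 4 * κ (T + 1) + 2 * κ T := by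
    have h1 := abs_le.1 (hκ (T + 1) _ (hx (T + 1)))
    have h2 := abs_le.1 (hκ T _ (hx (T + 1)))
    have h3 := abs_le.1 (hκ (T + 1) _ hz)
    have h4 := abs_le.1 (hκ T _ hz)
    have h5 := hA _ (hx (T + 1)) _ (hy T)
    have h6 := hA _ hz _ (hy T)
    rw [Set.mem_Icc] at h5 h6
    simp only [payoff] at h5 h6
    rw [hu]
    simp only [sub_dotProduct, dotProduct_add, dotProduct_sub]
    linarith [h1.1, h1.2, h2.1, h2.2, h3.1, h3.2, h4.1, h4.2, h5.1, h5.2, h6.1, h6.2]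
  have hsum : ∀ T, ∑ t ∈ Finset.range (T + 1),
      ((x (t + 2) - x (t + 1)) ⬝ᵥ (u (t + 1) - u t - ε (t + 1))
          - 3 * quadForm H (x (t + 2) - x (t + 1)))
      ≤ 2 - 2 * ∑ t ∈ Finset.range (T + 1), quadForm H (x (t + 2) - x (t + 1))
        + 1 / 2 * ∑ t ∈ Finset.range T, quadForm G (y (t + 2) - y (t + 1))
        + 4 * ∑ t ∈ Finset.range (T + 1), κ t ^ 2 + ∑ t ∈ Finset.range T, κ t ^ 2 := by
    intro T
    induction T with
    | zero =>
      have h5 := hA _ (hx 1) _ (hy 0)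
      have h6 := hA _ (hx 0) _ (hy 0)
      rw [Set.mem_Icc] at h5 h6
      simp only [payoff, zero_add, Nat.reduceAdd] at h5 h6
      have := quadForm_nonneg hH.1 (x 2 - x 1)
      have := sq_nonneg (κ 0)
      simp [hu, hu0, hε0, sub_dotProduct]
      linarith [h5.1, h5.2, h6.1, h6.2]
    | succ T ih =>
      have e1 := Finset.sum_range_succ (fun t => (x (t + 2) - x (t + 1)) ⬝ᵥ
        (u (t + 1) - u t - ε (t + 1)) - 3 * quadForm H (x (t + 2) - x (t + 1))) (T + 1)
      have e2 := Finset.sum_range_succ (fun t => quadForm H (x (t + 2) - x (t + 1))) (T + 1)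
      have e3 := Finset.sum_range_succ (fun t => quadForm G (y (t + 2) - y (t + 1))) T
      have e4 := Finset.sum_range_succ (fun t => κ t ^ 2) T
      have e5 := Finset.sum_range_succ (fun t => κ t ^ 2) (T + 1)
      rw [e1, e2, e3, e5]
      -- The newest error cancels. What remains is the opponent's move and two older errors.
      have hb : u (T + 1 + 1) - u (T + 1) - ε (T + 1 + 1)
          = A *ᵥ (y (T + 2) - y (T + 1)) - 2 • ε (T + 1) + (ε T) := by
        rw [hu, hu, Matrix.mulVec_sub]; module
      set Δ := x (T + 1 + 2) - x (T + 1 + 1)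
      have hΔ := quadForm_nonneg hH.1 Δ
      have hw : ∀ z ∈ X, |z ⬝ᵥ (- 2 • ε (T + 1) + ε T)| ≤ 2 * κ (T + 1) + κ T := by
        intro z hz
        have h1 := abs_le.1 (hκ (T + 1) _ hz)
        have h2 := abs_le.1 (hκ T _ hz)
        simp only [dotProduct_add, dotProduct_smul]
        rw [abs_le]
        constructor <;> simp <;> linarith [h1.1, h1.2, h2.1, h2.2]
      have h7 := sq_dotProduct_le hH hw Δ
      have h8 := sq_payoff_le hA hH hG Δ (y (T + 2) - y (T + 1))
      have hd := quadForm_nonneg hG.1 (y (T + 2) - y (T + 1))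
      -- Young's inequality, here and in `h8'`: each cross term costs `1/2 * quadForm H Δ`, so of
      -- the coefficient `3` a `2` is left.
      have h7' : Δ ⬝ᵥ (- 2 • ε (T + 1) + ε T)
          ≤ 1 / 2 * quadForm H Δ + 1 / 2 * (2 * κ (T + 1) + κ T) ^ 2 := by
        refine abs_le_of_sq_le_sq' ?_ (by positivity) |>.2
        nlinarith [sq_nonneg (quadForm H Δ - (2 * κ (T + 1) + κ T) ^ 2)]
      have h8' : payoff A Δ (y (T + 2) - y (T + 1))
          ≤ 1 / 2 * quadForm H Δ + 1 / 2 * quadForm G (y (T + 2) - y (T + 1)) := by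
        refine abs_le_of_sq_le_sq' ?_ (by positivity) |>.2
        nlinarith [sq_nonneg (quadForm H Δ - quadForm G (y (T + 2) - y (T + 1)))]
      have h9 : Δ ⬝ᵥ (u (T + 1 + 1) - u (T + 1) - ε (T + 1 + 1))
          = payoff A Δ (y (T + 2) - y (T + 1)) + Δ ⬝ᵥ (- 2 • ε (T + 1) + ε T) := by
        rw [hb, payoff, ← dotProduct_add]; congr 1; module
      rw [h9]
      have h10 : (2 * κ (T + 1) + κ T) ^ 2 ≤ 2 * (4 * κ (T + 1) ^ 2 + κ T ^ 2) := by
        nlinarith [sq_nonneg (2 * κ (T + 1) - κ T)]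
      linarith
  have hT := hsum T
  have hlast := quadForm_nonneg hG.1 (y (T + 2) - y (T + 1))
  rw [Finset.sum_range_succ (fun t => quadForm G (y (t + 2) - y (t + 1))) T]
  have e4 : ∑ t ∈ Finset.range (T + 1), κ t ^ 2 = ∑ t ∈ Finset.range T, κ t ^ 2 + κ T ^ 2 :=
        Finset.sum_range_succ _ T
  have := sq_nonneg (κ T)
  simp only [payoff, zero_add, Nat.reduceAdd] at hreg hxq ⊢
  linarith

theorem sum_Icc_one {M : Type*} [AddCommMonoid M] (f : ℕ → M) (t : ℕ) :
    ∑ l ∈ Finset.Icc 1 t, f l = ∑ l ∈ Finset.range t, f (l + 1) := by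
  induction t with
  | zero => simp
  | succ t ih => rw [Finset.sum_Icc_succ_top (by omega), ih, Finset.sum_range_succ]

/-- The summand at `t = 0` is `1 / 0 = 0`, so the sum is a harmonic number. -/
theorem sum_range_inv_le (T : ℕ) :
    ∑ t ∈ Finset.range (T + 1), (1 : ℝ) / t ≤ 1 + Real.log (T + 1) := by
  rw [Finset.sum_range_succ']
  have h := harmonic_le_one_add_log T
  have h2 : ((harmonic T : ℚ) : ℝ) = ∑ t ∈ Finset.range T, (1 : ℝ) / ((t + 1 : ℕ) : ℝ) := by
    simp [harmonic]
  have h3 : Real.log T ≤ Real.log (T + 1) := by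
    rcases Nat.eq_zero_or_pos T with rfl | hT
    · simp
    · exact Real.log_le_log (by positivity) (by linarith)
  rw [← h2]
  simp
  linarith

end Gap

/-! ### The outputs of the algorithm stay in the action set -/

namespace Learner

variable {d : ℕ} (P : Learner d)

theorem explorationMean_mem (hd : 1 ≤ d) (hX : Convex ℝ P.X) (hp : ∀ i, P.p i ∈ P.X) :
    P.explorationMean ∈ P.X := by
  have hd' : (0 : ℝ) < d := by exact_mod_cast hd
  have := hX.sum_mem (t := Finset.univ) (w := fun _ : Fin d => 1 / (d : ℝ)) (z := P.p)
    (fun _ _ => by positivity) (by simp; field_simp) (fun i _ => hp i)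
  rwa [← Finset.smul_sum] at this

/-- Compactness and continuity provide a maximizer, so the choice in `argmaxOn` is a genuine one.
With `η = 1/6` the term `φ/η` is `3 xᵀ H x`. -/
theorem oftrl_spec (hd : 1 ≤ d) (hXc : IsCompact P.X) (hp : ∀ i, P.p i ∈ P.X) (hη : P.η = 1 / 6)
    (c : ℕ → ℕ → Coin d) (r : ℕ → ℕ → ℝ) (t : ℕ) :
    P.oftrl c r (t + 2) ∈ P.X ∧
      IsMaxOn (fun z => z ⬝ᵥ (∑ l ∈ Finset.range (t + 1), P.utilityHat c r (l + 1)
        + P.utilityHat c r (t + 1)) - 3 * quadForm P.H z) P.X (P.oftrl c r (t + 2)) := by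
  have hf : (fun z => z ⬝ᵥ (∑ l ∈ Finset.range (t + 1), P.utilityHat c r (l + 1)
        + P.utilityHat c r (t + 1)) - 3 * quadForm P.H z)
      = fun x => x ⬝ᵥ (∑ l ∈ Finset.Icc 1 (t + 1), P.utilityHat c r l + P.utilityHat c r (t + 1))
        - 1 / P.η * P.regularizer x := by
    funext x
    have : ∑ l ∈ Finset.Icc 1 (t + 1), P.utilityHat c r l
        = ∑ l ∈ Finset.range (t + 1), P.utilityHat c r (l + 1) := sum_Icc_one _ _
    rw [this, hη, regularizer, quadForm]; ring
  have hcont : Continuous (fun z => z ⬝ᵥ (∑ l ∈ Finset.range (t + 1), P.utilityHat c r (l + 1)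
        + P.utilityHat c r (t + 1)) - 3 * quadForm P.H z) := by
    have := continuous_quadForm P.H
    unfold dotProduct
    fun_prop
  obtain ⟨x, hx, hmax⟩ := hXc.exists_isMaxOn ⟨_, hp ⟨0, hd⟩⟩ hcont.continuousOn
  rw [oftrl, ← hf, argmaxOn]
  exact Classical.epsilon_spec (p := fun x => x ∈ P.X ∧ IsMaxOn _ P.X x) ⟨x, hx, hmax⟩

theorem oftrl_mem (hd : 1 ≤ d) (hXc : IsCompact P.X) (hX : Convex ℝ P.X) (hp : ∀ i, P.p i ∈ P.X)
    (hη : P.η = 1 / 6) (c : ℕ → ℕ → Coin d) (r : ℕ → ℕ → ℝ) (t : ℕ) : P.oftrl c r t ∈ P.X := by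
  rcases t with _ | _ | t
  · rw [oftrl]; exact P.explorationMean_mem hd hX hp
  · rw [oftrl]; exact P.explorationMean_mem hd hX hp
  · exact (P.oftrl_spec hd hXc hp hη c r t).1

theorem average_mem (hd : 1 ≤ d) (hXc : IsCompact P.X) (hX : Convex ℝ P.X) (hp : ∀ i, P.p i ∈ P.X)
    (hη : P.η = 1 / 6) (c : ℕ → ℕ → Coin d) (r : ℕ → ℕ → ℝ) {t : ℕ} (ht : 1 ≤ t) :
    P.average c r t ∈ P.X := by
  have ht' : (0 : ℝ) < t := by exact_mod_cast ht
  have := hX.sum_mem (t := Finset.Icc 1 t) (w := fun _ => 1 / (t : ℝ)) (z := P.oftrl c r)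
    (fun _ _ => by positivity) (by simp; field_simp)
    (fun i _ => P.oftrl_mem hd hXc hX hp hη c r i)
  rwa [← Finset.smul_sum] at this

theorem smul_average (c : ℕ → ℕ → Coin d) (r : ℕ → ℕ → ℝ) {t : ℕ} :
    (t : ℝ) • P.average c r t = ∑ l ∈ Finset.range t, P.oftrl c r (l + 1) := by
  rcases Nat.eq_zero_or_pos t with rfl | ht
  · simp
  have ht' : (t : ℝ) ≠ 0 := by positivity
  rw [average, smul_smul, mul_one_div_cancel ht', one_smul, sum_Icc_one]

end Learner

/-! ### Regret of the algorithm with estimated utilities -/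

section Gap

variable {n m : ℕ} {P : Learner n} {Q : Learner m} {A : Matrix (Fin n) (Fin m) ℝ}

/-- `player_regret` for the algorithm, when the estimation error in phase `t` is at most
`√(K n³ / t³)` on the action set. -/
theorem Learner.regret_le (hn : 1 ≤ n) (hm : 1 ≤ m) (hXc : IsCompact P.X) (hX : Convex ℝ P.X)
    (hYc : IsCompact Q.X) (hY : Convex ℝ Q.X)
    (hA : ∀ x ∈ P.X, ∀ y ∈ Q.X, payoff A x y ∈ Set.Icc (-1 : ℝ) 1)
    (hp : ∀ i, P.p i ∈ P.X) (hq : ∀ i, Q.p i ∈ Q.X)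
    (hH : IsEllipsoidApprox P.X P.H) (hG : IsEllipsoidApprox Q.X Q.H)
    (hηP : P.η = 1 / 6) (hηQ : Q.η = 1 / 6)
    (c : ℕ → ℕ → Coin n) (e : ℕ → ℕ → Coin m) (r r' : ℕ → ℕ → ℝ) {K : ℝ} (hK : 0 ≤ K)
    (herr : ∀ t, 1 ≤ t → ∀ z ∈ P.X, |z ⬝ᵥ (P.thetaHat c r t - A *ᵥ Q.average e r' t)|
      ≤ Real.sqrt (K * n ^ 3 / t ^ 3))
    (T : ℕ) {z : Fin n → ℝ} (hz : z ∈ P.X) :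
    ∑ t ∈ Finset.range (T + 1), payoff A (z - P.oftrl c r (t + 1)) (Q.oftrl e r' (t + 1))
      ≤ (37 + 8 * K) * n ^ 3 * (1 + Real.log (T + 1))
        - 2 * ∑ t ∈ Finset.range (T + 1), quadForm P.H (P.oftrl c r (t + 2) - P.oftrl c r (t + 1))
        + 1 / 2 * ∑ t ∈ Finset.range (T + 1),
          quadForm Q.H (Q.oftrl e r' (t + 2) - Q.oftrl e r' (t + 1)) := by
  set ε : ℕ → Fin n → ℝ := fun t => (t : ℝ) • (P.thetaHat c r t - A *ᵥ Q.average e r' t) with hε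
  set κ : ℕ → ℝ := fun t => Real.sqrt (K * n ^ 3 / t) with hκ
  -- `t • average` is the sum of the first `t` outputs, so consecutive differences recover the
  -- opponent's latest output.
  have hu : ∀ t, P.utilityHat c r (t + 1) = A *ᵥ Q.oftrl e r' (t + 1) + ε (t + 1) - ε t := by
    intro t
    simp only [hε, Learner.utilityHat, smul_sub, ← Matrix.mulVec_smul, Q.smul_average,
      Finset.sum_range_succ, Matrix.mulVec_add]
    simp
    module
  have hκε : ∀ t, ∀ z ∈ P.X, |z ⬝ᵥ ε t| ≤ κ t := by
    intro t z hz
    rcases Nat.eq_zero_or_pos t with rfl | ht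
    · simp [hε, hκ]
    have ht' : (0 : ℝ) < t := by exact_mod_cast ht
    have h := herr t ht z hz
    simp only [hε, hκ]
    rw [dotProduct_smul, smul_eq_mul, abs_mul, abs_of_pos ht']
    calc _ ≤ (t : ℝ) * Real.sqrt (K * n ^ 3 / t ^ 3) := by gcongr
      _ = Real.sqrt (t ^ 2 * (K * n ^ 3 / t ^ 3)) := by
        rw [Real.sqrt_mul (by positivity), Real.sqrt_sq ht'.le]
      _ = _ := by congr 1; field_simp
  have hreg := player_regret hX hA hH hG (x := P.oftrl c r) (u := P.utilityHat c r) (ε := ε)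
    (y := Q.oftrl e r') (κ := κ) (fun t => P.oftrl_mem hn hXc hX hp hηP c r _)
    (fun t => Q.oftrl_mem hm hYc hY hq hηQ e r' _) (by simp [Learner.utilityHat, Learner.thetaHat])
    (by simp [hε]) hu (fun t => (P.oftrl_spec hn hXc hp hηP c r t).2) hκε T hz
  have hκ2 : ∀ t : ℕ, κ t ^ 2 = K * n ^ 3 * (1 / t) := by
    intro t; simp only [hκ]; rw [Real.sq_sqrt (by positivity)]; ring
  have hsum : ∑ t ∈ Finset.range (T + 1), κ t ^ 2 ≤ K * n ^ 3 * (1 + Real.log (T + 1)) := by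
    simp only [hκ2, ← Finset.mul_sum]
    exact mul_le_mul_of_nonneg_left (sum_range_inv_le T) (by positivity)
  have hn' : (1 : ℝ) ≤ n := by exact_mod_cast hn
  have hn2 : (n : ℝ) * (n + 1) ≤ 2 * n ^ 3 := by nlinarith [mul_nonneg (sub_nonneg.2 hn') (sq_nonneg (n : ℝ)), mul_nonneg (sub_nonneg.2 hn') (by positivity : (0:ℝ) ≤ n)]
  have hn3 : (1 : ℝ) ≤ n ^ 3 := one_le_pow₀ hn'
  have hone : ∀ t : ℕ, (1 : ℝ) / t ≤ 1 := by
    intro t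
    rcases Nat.eq_zero_or_pos t with rfl | ht
    · simp
    · rw [div_le_one (by positivity)]; exact_mod_cast ht
  have hκ1 : ∀ t, 2 * κ t ≤ 1 + K * n ^ 3 := by
    intro t
    have : κ t ^ 2 ≤ K * n ^ 3 := by
      rw [hκ2]; exact mul_le_of_le_one_right (by positivity) (hone t)
    nlinarith [sq_nonneg (κ t - 1)]
  have hlog : 0 ≤ Real.log ((T : ℝ) + 1) := Real.log_nonneg (by linarith [(Nat.cast_nonneg T : (0:ℝ) ≤ T)])
  have h1 := hκ1 (T + 1)
  have h2 := hκ1 T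
  have h3 : 0 ≤ K * n ^ 3 * Real.log ((T : ℝ) + 1) := by positivity
  have h4 : 0 ≤ (n : ℝ) ^ 3 * Real.log ((T : ℝ) + 1) := by positivity
  -- The constants: `15 n (n + 1) ≤ 30 n³`, the end terms give at most `4 + 3 (1 + K n³)`, and the
  -- squared errors give `5 K n³ (1 + log (T + 1))`; together `37 + 8 K`.
  nlinarith

end Gap

/-- The hypotheses on the inputs of one player. -/
structure Learner.Admissible {d : ℕ} (P : Learner d) : Prop where
  one_le : 1 ≤ d
  compact : IsCompact P.X
  convex : Convex ℝ P.X
  design : IsExplorationDesign P.X P.p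
  ellipsoid : IsEllipsoidApprox P.X P.H
  step : P.η = 1 / 6

/-! ### Symmetry between the players -/

section Interaction

variable {n m : ℕ} (P : Learner n) (Q : Learner m) (A : Matrix (Fin n) (Fin m) ℝ)
  (c : ℕ → ℕ → Coin n) (e : ℕ → ℕ → Coin m)

/-- The plays of a phase depend on earlier rewards only, so strong induction on the phase applies.
This transfers results about the row player to the column player, with matrix `-Aᵀ`. -/
theorem reward_swap : reward Q P (-Aᵀ) e c = -reward P Q A c e := by
  funext t
  induction t using Nat.strong_induction_on with
  | _ t ih =>
    funext s
    rw [reward_eq, Pi.neg_apply, Pi.neg_apply, reward_eq, payoff_neg_transpose, rowPlay, rowPlay,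
      colPlay, colPlay, Q.play_congr e (fun l hl => ih l hl) s,
      P.play_congr c (r := -reward Q P (-Aᵀ) e c) (r' := reward P Q A c e)
        (fun l hl => by rw [Pi.neg_apply, ih l hl, Pi.neg_apply, neg_neg]) s]

end Interaction

/-! ### From regret to approximate equilibria -/

section Nash

variable {n m : ℕ} {P : Learner n} {Q : Learner m} {A : Matrix (Fin n) (Fin m) ℝ}

theorem mixing_nonneg (t : ℕ) : 0 ≤ mixing t := by unfold mixing; positivity

theorem mixing_le_inv {t : ℕ} (ht : 1 ≤ t) : mixing t ≤ 1 / t := by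
  have : (1 : ℝ) ≤ t := by exact_mod_cast ht
  unfold mixing
  apply one_div_le_one_div_of_le (by positivity)
  nlinarith

theorem mixing_le_one {t : ℕ} (ht : 1 ≤ t) : mixing t ≤ 1 := by
  have : (1 : ℝ) ≤ t := by exact_mod_cast ht
  refine (mixing_le_inv ht).trans ?_
  rw [div_le_one (by positivity)]; exact this

theorem Learner.Admissible.average_mem (hP : P.Admissible) (c : ℕ → ℕ → Coin n) (r : ℕ → ℕ → ℝ)
    {t : ℕ} (ht : 1 ≤ t) : P.average c r t ∈ P.X :=
  P.average_mem hP.one_le hP.compact hP.convex hP.design.1 hP.step c r ht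

/-- An unperturbed round has this form with `z` the average itself, so both kinds of round are
treated alike. -/
theorem Learner.Admissible.exists_play_eq (hP : P.Admissible) (c : ℕ → ℕ → Coin n)
    (r : ℕ → ℕ → ℝ) {t : ℕ} (ht : 1 ≤ t) (s : ℕ) :
    ∃ z ∈ P.X, P.play c r t s = (1 - mixing t) • P.average c r t + mixing t • z := by
  unfold Learner.play
  split_ifs
  · exact ⟨_, hP.design.1 _, rfl⟩
  · exact ⟨_, hP.average_mem c r ht, by module⟩

theorem payoff_combo_right (A : Matrix (Fin n) (Fin m) ℝ) (a : ℝ) (x : Fin n → ℝ)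
    (y z : Fin m → ℝ) :
    payoff A x ((1 - a) • y + a • z) = (1 - a) * payoff A x y + a * payoff A x z := by
  simp [payoff, Matrix.mulVec_add, Matrix.mulVec_smul]

theorem payoff_combo_left (A : Matrix (Fin n) (Fin m) ℝ) (a : ℝ) (x z : Fin n → ℝ)
    (y : Fin m → ℝ) :
    payoff A ((1 - a) • x + a • z) y = (1 - a) * payoff A x y + a * payoff A z y := by
  simp [payoff]

/-- Small estimation errors make all iterates of phase `t` approximate equilibria. -/
theorem isApproxNash_of_error (hP : P.Admissible) (hQ : Q.Admissible)
    (hA : ∀ x ∈ P.X, ∀ y ∈ Q.X, payoff A x y ∈ Set.Icc (-1 : ℝ) 1)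
    (c : ℕ → ℕ → Coin n) (e : ℕ → ℕ → Coin m) (r r' : ℕ → ℕ → ℝ) {K : ℝ} (hK : 0 ≤ K)
    (herrP : ∀ t, 1 ≤ t → ∀ z ∈ P.X, |z ⬝ᵥ (P.thetaHat c r t - A *ᵥ Q.average e r' t)|
      ≤ Real.sqrt (K * n ^ 3 / t ^ 3))
    (herrQ : ∀ t, 1 ≤ t → ∀ w ∈ Q.X, |w ⬝ᵥ (Q.thetaHat e r' t - (-Aᵀ) *ᵥ P.average c r t)|
      ≤ Real.sqrt (K * m ^ 3 / t ^ 3))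
    {t : ℕ} (ht : 1 ≤ t) (s : ℕ) :
    IsApproxNash P.X Q.X A ((43 + 8 * K) * (n ^ 3 + m ^ 3) * (1 + Real.log t) / t)
      (P.play c r t s) (Q.play e r' t s) := by
  have hA' : ∀ y ∈ Q.X, ∀ x ∈ P.X, payoff (-Aᵀ) y x ∈ Set.Icc (-1 : ℝ) 1 := by
    intro y hy x hx
    rw [payoff_neg_transpose]
    have := hA x hx y hy
    rw [Set.mem_Icc] at this ⊢
    constructor <;> linarith
  have ht' : (1 : ℝ) ≤ t := by exact_mod_cast ht
  have ht0 : (0 : ℝ) < t := by linarith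
  set x := P.average c r t with hx
  set y := Q.average e r' t with hy
  have hxm : x ∈ P.X := hP.average_mem c r ht
  have hym : y ∈ Q.X := hQ.average_mem e r' ht
  have hgap : ∀ z ∈ P.X, ∀ w ∈ Q.X, payoff A z y - payoff A x w
      ≤ (37 + 8 * K) * (n ^ 3 + m ^ 3) * (1 + Real.log t) / t := by
    intro z hz w hw
    obtain ⟨T, rfl⟩ : ∃ T, t = T + 1 := ⟨t - 1, by omega⟩
    have h1 := Learner.regret_le hP.one_le hQ.one_le hP.compact hP.convex hQ.compact hQ.convex hA
      hP.design.1 hQ.design.1 hP.ellipsoid hQ.ellipsoid hP.step hQ.step c e r r' hK herrP T hz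
    have h2 := Learner.regret_le hQ.one_le hP.one_le hQ.compact hQ.convex hP.compact hP.convex hA'
      hQ.design.1 hP.design.1 hQ.ellipsoid hP.ellipsoid hQ.step hP.step e c r' r hK herrQ T hw
    -- The game being zero-sum, the payoffs of the played pairs of outputs cancel in the sum of the
    -- regrets.
    have h3 : (∑ t ∈ Finset.range (T + 1), payoff A (z - P.oftrl c r (t + 1)) (Q.oftrl e r' (t + 1)))
        + ∑ t ∈ Finset.range (T + 1), payoff (-Aᵀ) (w - Q.oftrl e r' (t + 1)) (P.oftrl c r (t + 1))
        = ((T + 1 : ℕ) : ℝ) * (payoff A z y - payoff A x w) := by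
      have e1 : ((T + 1 : ℕ) : ℝ) * payoff A z y
          = ∑ t ∈ Finset.range (T + 1), payoff A z (Q.oftrl e r' (t + 1)) := by
        simp only [payoff, hy]
        rw [← smul_eq_mul, ← dotProduct_smul, ← Matrix.mulVec_smul, Q.smul_average,
          Matrix.mulVec_sum, dotProduct_sum]
      have e2 : ((T + 1 : ℕ) : ℝ) * payoff A x w
          = ∑ t ∈ Finset.range (T + 1), payoff A (P.oftrl c r (t + 1)) w := by
        simp only [payoff, hx]
        rw [← smul_eq_mul, ← smul_dotProduct, P.smul_average, sum_dotProduct]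
      rw [mul_sub, e1, e2, ← Finset.sum_add_distrib, ← Finset.sum_sub_distrib]
      refine Finset.sum_congr rfl fun t _ => ?_
      rw [payoff_neg_transpose]
      simp only [payoff, sub_dotProduct, Matrix.mulVec_sub, dotProduct_sub]
      ring
    have hS1 := Finset.sum_nonneg fun t (_ : t ∈ Finset.range (T + 1)) =>
      quadForm_nonneg hP.ellipsoid.1 (P.oftrl c r (t + 2) - P.oftrl c r (t + 1))
    have hS2 := Finset.sum_nonneg fun t (_ : t ∈ Finset.range (T + 1)) =>
      quadForm_nonneg hQ.ellipsoid.1 (Q.oftrl e r' (t + 2) - Q.oftrl e r' (t + 1))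
    -- Each player's squared movement occurs with total coefficient `-2 + 1/2 < 0` and is dropped.
    rw [le_div_iff₀ ht0]
    push_cast at *
    linarith
  obtain ⟨x1, hx1, hxe⟩ := hP.exists_play_eq c r ht s
  obtain ⟨y1, hy1, hye⟩ := hQ.exists_play_eq e r' ht s
  rw [← hx] at hxe
  rw [← hy] at hye
  have hl0 := mixing_nonneg t
  have hl1 := mixing_le_one ht
  have hl2 := mixing_le_inv ht
  have hxp : P.play c r t s ∈ P.X := by
    rw [hxe]; exact hP.convex hxm hx1 (by linarith) hl0 (by ring)
  have hyp : Q.play e r' t s ∈ Q.X := by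
    rw [hye]; exact hQ.convex hym hy1 (by linarith) hl0 (by ring)
  have right : ∀ z ∈ P.X, |payoff A z (Q.play e r' t s) - payoff A z y| ≤ 2 * mixing t := by
    intro z hz
    have h1 := hA z hz y hym
    have h2 := hA z hz y1 hy1
    rw [Set.mem_Icc] at h1 h2
    rw [hye, payoff_combo_right, abs_le]
    constructor <;> nlinarith [h1.1, h1.2, h2.1, h2.2]
  have left : ∀ w ∈ Q.X, |payoff A (P.play c r t s) w - payoff A x w| ≤ 2 * mixing t := by
    intro w hw
    have h1 := hA x hxm w hw
    have h2 := hA x1 hx1 w hw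
    rw [Set.mem_Icc] at h1 h2
    rw [hxe, payoff_combo_left, abs_le]
    constructor <;> nlinarith [h1.1, h1.2, h2.1, h2.2]
  have hn3 : (1 : ℝ) ≤ n ^ 3 := one_le_pow₀ (by exact_mod_cast hP.one_le)
  have hlog : 0 ≤ Real.log t := Real.log_nonneg ht'
  -- Passing from the averages to the plays changes three payoffs by at most `2 λ_t` each, and `λ_t
  -- ≤ 1/t`; so `37` becomes `43`.
  have hbound : (37 + 8 * K) * (n ^ 3 + m ^ 3) * (1 + Real.log t) / t + 6 * mixing t
      ≤ (43 + 8 * K) * (n ^ 3 + m ^ 3) * (1 + Real.log t) / t := by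
    have : 1 / (t : ℝ) ≤ (n ^ 3 + m ^ 3) * (1 + Real.log t) / t := by
      gcongr
      have : (0 : ℝ) ≤ m ^ 3 := by positivity
      nlinarith
    have e : (43 + 8 * K) * (n ^ 3 + m ^ 3) * (1 + Real.log t) / t
        = (37 + 8 * K) * (n ^ 3 + m ^ 3) * (1 + Real.log t) / t
          + 6 * ((n ^ 3 + m ^ 3) * (1 + Real.log t) / t) := by ring
    rw [e]
    linarith
  refine ⟨hxp, hyp, fun z hz w hw => ?_⟩
  have h1 := abs_le.1 (right z hz)
  have h2 := abs_le.1 (right x hxm)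
  have h3 := abs_le.1 (left _ hyp)
  have h4 := abs_le.1 (left w hw)
  have h5 := hgap z hz y hym
  have h6 := hgap x hxm w hw
  constructor <;> linarith [h1.1, h1.2, h2.1, h2.2, h3.1, h3.2, h4.1, h4.2]

end Nash

/-! ### Phase index against round index -/

section Rate

variable {δ : ℝ}

theorem two_lt_log_phase (hδ₀ : 0 < δ) (hδ₁ : δ ≤ 1 / 2) {t : ℕ} (ht : 1 ≤ t) :
    2 < Real.log (8 * (t : ℝ) ^ 2 / δ) := by
  have ht' : (1 : ℝ) ≤ t := by exact_mod_cast ht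
  have h16 : (16 : ℝ) ≤ 8 * (t : ℝ) ^ 2 / δ := by
    rw [le_div_iff₀ hδ₀]; nlinarith
  have h2 : Real.log 16 = 4 * Real.log 2 := by
    rw [show (16 : ℝ) = 2 ^ 4 by norm_num, Real.log_pow]; norm_num
  have := Real.log_le_log (by norm_num) h16
  linarith [Real.log_two_gt_d9]

theorem log_phase_mono (hδ₀ : 0 < δ) {t u : ℕ} (ht : 1 ≤ t) (htu : t ≤ u) :
    Real.log (8 * (t : ℝ) ^ 2 / δ) ≤ Real.log (8 * (u : ℝ) ^ 2 / δ) := by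
  have ht' : (1 : ℝ) ≤ t := by exact_mod_cast ht
  have htu' : (t : ℝ) ≤ u := by exact_mod_cast htu
  apply Real.log_le_log (by positivity)
  gcongr

theorem le_batch (δ : ℝ) (t : ℕ) :
    Real.log (8 * (t : ℝ) ^ 2 / δ) * (t : ℝ) ^ 3 ≤ batch δ t := Nat.le_ceil _

theorem one_le_batch (hδ₀ : 0 < δ) (hδ₁ : δ ≤ 1 / 2) {t : ℕ} (ht : 1 ≤ t) : 1 ≤ batch δ t := by
  have ht' : (1 : ℝ) ≤ t := by exact_mod_cast ht
  have := two_lt_log_phase hδ₀ hδ₁ ht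
  exact Nat.one_le_ceil_iff.2 (by positivity)

theorem batch_le (hδ₀ : 0 < δ) (hδ₁ : δ ≤ 1 / 2) {t : ℕ} (ht : 1 ≤ t) :
    (batch δ t : ℝ) ≤ 2 * (Real.log (8 * (t : ℝ) ^ 2 / δ) * (t : ℝ) ^ 3) := by
  have ht' : (1 : ℝ) ≤ t := by exact_mod_cast ht
  have h1 := two_lt_log_phase hδ₀ hδ₁ ht
  have h2 : (1 : ℝ) ≤ (t : ℝ) ^ 3 := one_le_pow₀ ht'
  have h3 : (batch δ t : ℝ) < Real.log (8 * (t : ℝ) ^ 2 / δ) * (t : ℝ) ^ 3 + 1 :=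
    Nat.ceil_lt_add_one (by positivity)
  nlinarith

theorem le_sum_batch (hδ₀ : 0 < δ) (hδ₁ : δ ≤ 1 / 2) (t : ℕ) :
    t ≤ ∑ l ∈ Finset.Icc 1 t, batch δ l := by
  calc t = ∑ l ∈ Finset.Icc 1 t, 1 := by simp
    _ ≤ _ := Finset.sum_le_sum fun l hl => one_le_batch hδ₀ hδ₁ (Finset.mem_Icc.1 hl).1

theorem le_sum_phaseOf (hδ₀ : 0 < δ) (hδ₁ : δ ≤ 1 / 2) (k : ℕ) :
    k ≤ ∑ l ∈ Finset.Icc 1 (phaseOf δ k), batch δ l :=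
  Nat.sInf_mem (s := {t | k ≤ ∑ l ∈ Finset.Icc 1 t, batch δ l}) ⟨k, le_sum_batch hδ₀ hδ₁ k⟩

theorem one_le_phaseOf (hδ₀ : 0 < δ) (hδ₁ : δ ≤ 1 / 2) {k : ℕ} (hk : 1 ≤ k) :
    1 ≤ phaseOf δ k := by
  by_contra h
  have h0 : phaseOf δ k = 0 := by omega
  have := le_sum_phaseOf hδ₀ hδ₁ k
  rw [h0] at this
  simp at this
  omega

theorem phaseOf_le (hδ₀ : 0 < δ) (hδ₁ : δ ≤ 1 / 2) (k : ℕ) : phaseOf δ k ≤ k :=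
  Nat.sInf_le (le_sum_batch hδ₀ hδ₁ k)

/-- There are `T` phases, each of length at most `2 T³` times the logarithm at `k`, which dominates
the logarithms of the phases because `T ≤ k`. -/
theorem le_phaseOf_pow (hδ₀ : 0 < δ) (hδ₁ : δ ≤ 1 / 2) {k : ℕ} (hk : 1 ≤ k) :
    (k : ℝ) ≤ 2 * (phaseOf δ k : ℝ) ^ 4 * Real.log (8 * (k : ℝ) ^ 2 / δ) := by
  have hT := one_le_phaseOf hδ₀ hδ₁ hk
  set T := phaseOf δ k with hTdef
  have h1 : (k : ℝ) ≤ ∑ l ∈ Finset.Icc 1 T, (batch δ l : ℝ) := by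
    exact_mod_cast le_sum_phaseOf hδ₀ hδ₁ k
  have hTk : T ≤ k := phaseOf_le hδ₀ hδ₁ k
  refine h1.trans ?_
  calc _ ≤ ∑ l ∈ Finset.Icc 1 T, 2 * (Real.log (8 * (k : ℝ) ^ 2 / δ) * (T : ℝ) ^ 3) := by
        refine Finset.sum_le_sum fun l hl => ?_
        obtain ⟨hl1, hl2⟩ := Finset.mem_Icc.1 hl
        have := two_lt_log_phase hδ₀ hδ₁ hl1
        have := log_phase_mono hδ₀ hl1 (hl2.trans hTk)
        refine (batch_le hδ₀ hδ₁ hl1).trans ?_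
        gcongr
        linarith
    _ = _ := by simp; ring

theorem phase_rate_le (hδ₀ : 0 < δ) (hδ₁ : δ ≤ 1 / 2) {k : ℕ} (hk : 1 ≤ k) :
    (1 + Real.log (phaseOf δ k)) / (phaseOf δ k) ≤ 6 * Real.log ((k : ℝ) + 1)
      * Real.log (8 * (k : ℝ) ^ 2 / δ) ^ (1 / 4 : ℝ) * (k : ℝ) ^ (-(1 / 4) : ℝ) := by
  have hT := one_le_phaseOf hδ₀ hδ₁ hk
  have hTk := phaseOf_le hδ₀ hδ₁ k
  have hpow := le_phaseOf_pow hδ₀ hδ₁ hk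
  have hL := two_lt_log_phase hδ₀ hδ₁ hk
  set T := phaseOf δ k
  set L := Real.log (8 * (k : ℝ) ^ 2 / δ)
  have hT' : (1 : ℝ) ≤ T := by exact_mod_cast hT
  have hTk' : (T : ℝ) ≤ k := by exact_mod_cast hTk
  have hk0 : (0 : ℝ) < k := by linarith
  have h1 : (k : ℝ) ^ (1 / 4 : ℝ) ≤ 2 * T * L ^ (1 / 4 : ℝ) := by
    have e : (2 * T * L ^ (1 / 4 : ℝ)) = ((2 * (T : ℝ)) ^ 4 * L) ^ (1 / 4 : ℝ) := by
      rw [Real.mul_rpow (by positivity) (by linarith), ← Real.rpow_natCast, ← Real.rpow_mul (by positivity)]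
      norm_num
    rw [e]
    refine Real.rpow_le_rpow hk0.le (hpow.trans ?_) (by norm_num)
    rw [mul_pow]
    have : 0 ≤ (T : ℝ) ^ 4 * L := by positivity
    nlinarith
  have h2 : 1 / (T : ℝ) ≤ 2 * L ^ (1 / 4 : ℝ) * (k : ℝ) ^ (-(1 / 4) : ℝ) := by
    rw [Real.rpow_neg hk0.le, ← div_eq_mul_inv, div_le_div_iff₀ (by linarith) (by positivity)]
    linarith
  -- Here `1 ≤ 2 log (k + 1)` since `log 2 > 1/2`.
  have h3 : 1 + Real.log T ≤ 3 * Real.log ((k : ℝ) + 1) := by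
    have a : Real.log T ≤ Real.log (k + 1) := Real.log_le_log (by linarith) (by linarith)
    have b : Real.log 2 ≤ Real.log (k + 1) := Real.log_le_log (by norm_num) (by linarith)
    linarith [Real.log_two_gt_d9]
  have h4 : 0 ≤ Real.log T := Real.log_nonneg hT'
  calc (1 + Real.log T) / T = (1 + Real.log T) * (1 / T) := by ring
    _ ≤ (3 * Real.log ((k : ℝ) + 1)) * (2 * L ^ (1 / 4 : ℝ) * (k : ℝ) ^ (-(1 / 4) : ℝ)) := by
      gcongr
      linarith
    _ = _ := by ring

end Rate

theorem IsApproxNash.mono {n m : ℕ} {X : Set (Fin n → ℝ)} {Y : Set (Fin m → ℝ)}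
    {A : Matrix (Fin n) (Fin m) ℝ} {ε ε' : ℝ} {x : Fin n → ℝ} {y : Fin m → ℝ}
    (h : IsApproxNash X Y A ε x y) (hε : ε ≤ ε') : IsApproxNash X Y A ε' x y :=
  ⟨h.1, h.2.1, fun z hz w hw => ⟨by linarith [(h.2.2 z hz w hw).1], by linarith [(h.2.2 z hz w hw).2]⟩⟩

/-! ### Selecting the rounds of a phase -/

section Rounds

/-- Past the last hit `Nat.nth` returns `0`, which the bound covers. This is why later statements
speak of all `s ≤ B`, including round `0`, which is never played. -/
theorem nth_Icc_le (B : ℕ) (a : ℕ → Prop) (j : ℕ) :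
    Nat.nth (fun s => s ∈ Finset.Icc 1 B ∧ a s) j ≤ B := by
  by_cases h : Nat.nth (fun s => s ∈ Finset.Icc 1 B ∧ a s) j = 0
  · rw [h]; exact Nat.zero_le _
  · exact (Finset.mem_Icc.1 (Nat.nth_mem_of_ne_zero h).1).2

theorem finite_Icc_and (B : ℕ) (a : ℕ → Prop) :
    (Set.ofPred fun s => s ∈ Finset.Icc 1 B ∧ a s).Finite :=
  (Finset.Icc 1 B).finite_toSet.subset fun _ h => h.1

theorem card_finite_Icc_and (B : ℕ) (a : ℕ → Prop) [DecidablePred a] :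
    (finite_Icc_and B a).toFinset.card = ((Finset.Icc 1 B).filter a).card := by
  congr 1
  ext s
  simp

theorem nth_Icc_mem (B : ℕ) (a : ℕ → Prop) [DecidablePred a] {j : ℕ}
    (hj : j < ((Finset.Icc 1 B).filter a).card) :
    Nat.nth (fun s => s ∈ Finset.Icc 1 B ∧ a s) j ∈ Finset.Icc 1 B ∧
      a (Nat.nth (fun s => s ∈ Finset.Icc 1 B ∧ a s) j) :=
  Nat.nth_mem_of_lt_card (finite_Icc_and B a) (by rwa [card_finite_Icc_and])

theorem nth_Icc_injOn (B : ℕ) (a : ℕ → Prop) [DecidablePred a] :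
    (Set.Iio ((Finset.Icc 1 B).filter a).card).InjOn
      (Nat.nth fun s => s ∈ Finset.Icc 1 B ∧ a s) := by
  rw [← card_finite_Icc_and]
  exact Nat.nth_injOn _

end Rounds

/-! ### Deterministic error of the least-squares estimate -/

section Estimator

variable {d : ℕ} {δ : ℝ} {t : ℕ} {c : ℕ → Coin d}

theorem EnoughSamples.lt_card_base (hES : EnoughSamples δ t c) (i : Fin d)
    (j : Fin (batch δ t / (4 * d))) :
    (i : ℕ) * (batch δ t / (4 * d)) + j
      < ((Finset.Icc 1 (batch δ t)).filter fun s => (c s).1 = false).card := by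
  have h2 : d * (batch δ t / (4 * d)) * 4 ≤ batch δ t := by
    calc _ = (batch δ t / (4 * d)) * (4 * d) := by ring
      _ ≤ _ := Nat.div_mul_le_self _ _
  generalize batch δ t / (4 * d) = q at *
  have h1 : ((i : ℕ) + 1) * q ≤ d * q := Nat.mul_le_mul_right _ i.2
  have h3 : ((d * q : ℕ) : ℝ)
      ≤ (((Finset.Icc 1 (batch δ t)).filter fun s => (c s).1 = false).card : ℝ) := by
    refine le_trans ?_ hES.2.1
    rw [le_div_iff₀ (by norm_num)]
    exact_mod_cast h2
  have h4 : d * q ≤ ((Finset.Icc 1 (batch δ t)).filter fun s => (c s).1 = false).card := by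
    exact_mod_cast h3
  have := j.2
  rw [add_mul] at h1
  omega

theorem EnoughSamples.lt_card_explore (hES : EnoughSamples δ t c) (i : Fin d)
    (j : Fin (batch δ t / (4 * d))) :
    (j : ℕ) < ((Finset.Icc 1 (batch δ t)).filter fun s => c s = (true, i)).card := by
  refine lt_of_lt_of_le j.2 ?_
  have h3 : ((batch δ t / (4 * d) : ℕ) : ℝ)
      ≤ (((Finset.Icc 1 (batch δ t)).filter fun s => c s = (true, i)).card : ℝ) := by
    refine le_trans ?_ (hES.2.2 i)
    refine Nat.cast_div_le.trans ?_
    push_cast; exact le_rfl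
  exact_mod_cast h3

theorem sum_vecMulVec_mulVec {d : ℕ} (p : Fin d → Fin d → ℝ) (w : Fin d → ℝ) :
    (∑ i, Matrix.vecMulVec (p i) (p i)) *ᵥ w = ∑ i, (p i ⬝ᵥ w) • p i := by
  rw [Matrix.sum_mulVec]
  refine Finset.sum_congr rfl fun i _ => ?_
  rw [Matrix.vecMulVec_mulVec]
  ext k
  simp [mul_comm]

/-- Least squares with `q` observations at each support point: if the noise of each point sums to
at most `q β`, then the estimate is off by at most `√2 d β` on the action set. -/
theorem least_squares_error {X : Set (Fin d → ℝ)} {p : Fin d → Fin d → ℝ} (hd : 1 ≤ d)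
    (hp : IsExplorationDesign X p) {q : ℕ} (hq : 0 < q) (θ : Fin d → ℝ) (b : Fin d → Fin q → ℝ)
    {β : ℝ} (hb : ∀ i, |∑ j, (b i j - p i ⬝ᵥ θ)| ≤ q * β) {x : Fin d → ℝ} (hx : x ∈ X) :
    |x ⬝ᵥ ((∑ i : Fin d, ∑ _j : Fin q, Matrix.vecMulVec (p i) (p i))⁻¹ *ᵥ
      ∑ i : Fin d, ∑ j : Fin q, b i j • p i - θ)| ≤ Real.sqrt 2 * d * β := by
  have hd' : (0 : ℝ) < d := by exact_mod_cast hd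
  have hq' : (0 : ℝ) < q := by exact_mod_cast hq
  have hβ : 0 ≤ β := by
    have := (abs_nonneg _).trans (hb ⟨0, hd⟩)
    exact nonneg_of_mul_nonneg_right this hq'
  obtain ⟨-, hV, hV2⟩ := hp
  set V := designMatrix p with hVdef
  set S := ∑ i, Matrix.vecMulVec (p i) (p i) with hS
  have hSV : S = (d : ℝ) • V := by
    rw [hVdef, designMatrix, smul_smul, mul_one_div_cancel hd'.ne', one_smul]
  have hM : (∑ i : Fin d, ∑ _j : Fin q, Matrix.vecMulVec (p i) (p i)) = ((q * d : ℝ)) • V := by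
    rw [mul_smul, ← hSV, hS, Finset.smul_sum]
    refine Finset.sum_congr rfl fun i _ => ?_
    simp [← Nat.cast_smul_eq_nsmul ℝ]
  have hdet : IsUnit V.det := hV.isUnit.map Matrix.detMonoidHom
  have hMinv : (((q * d : ℝ)) • V)⁻¹ = ((q * d : ℝ))⁻¹ • V⁻¹ := by
    refine Matrix.inv_eq_left_inv ?_
    rw [smul_mul_smul_comm, Matrix.nonsing_inv_mul _ hdet, inv_mul_cancel₀ (by positivity), one_smul]
  set w := V⁻¹ *ᵥ x with hw
  have hsym : ∀ z, x ⬝ᵥ (V⁻¹ *ᵥ z) = w ⬝ᵥ z := by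
    intro z
    rw [Matrix.dotProduct_mulVec, hw, ← Matrix.mulVec_transpose]
    congr 2
    have := hV.1.inv
    rw [Matrix.IsHermitian, Matrix.conjTranspose_eq_transpose_of_trivial] at this
    exact this
  set D : Fin d → ℝ := fun i => ∑ j, (b i j - p i ⬝ᵥ θ) with hD
  have hVw : V *ᵥ w = x := by
    rw [hw, Matrix.mulVec_mulVec, Matrix.mul_nonsing_inv _ hdet, Matrix.one_mulVec]
  have hθ : θ = ((q * d : ℝ))⁻¹ • (V⁻¹ *ᵥ ∑ i : Fin d, ∑ j : Fin q, (p i ⬝ᵥ θ) • p i) := by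
    have e : ∑ i : Fin d, ∑ j : Fin q, (p i ⬝ᵥ θ) • p i = ((q * d : ℝ)) • (V *ᵥ θ) := by
      rw [mul_smul, ← Matrix.smul_mulVec, ← hSV, hS, sum_vecMulVec_mulVec, Finset.smul_sum]
      refine Finset.sum_congr rfl fun i _ => ?_
      simp [← Nat.cast_smul_eq_nsmul ℝ]
    rw [e, Matrix.mulVec_smul, smul_smul, inv_mul_cancel₀ (by positivity), one_smul,
      Matrix.mulVec_mulVec, Matrix.nonsing_inv_mul _ hdet, Matrix.one_mulVec]
  -- With `w = V⁻¹ x` the error is a sum over support points of total noise times `w ⬝ᵥ p i`, ready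
  -- for Cauchy–Schwarz.
  have hmain : x ⬝ᵥ ((∑ i : Fin d, ∑ _j : Fin q, Matrix.vecMulVec (p i) (p i))⁻¹ *ᵥ
      ∑ i : Fin d, ∑ j : Fin q, b i j • p i - θ) = ((q * d : ℝ))⁻¹ * ∑ i, D i * (w ⬝ᵥ p i) := by
    rw [hM, hMinv, Matrix.smul_mulVec]
    nth_rewrite 1 [hθ]
    rw [← smul_sub, ← Matrix.mulVec_sub, dotProduct_smul, smul_eq_mul, hsym]
    congr 1
    rw [← Finset.sum_sub_distrib, dotProduct_sum]
    refine Finset.sum_congr rfl fun i _ => ?_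
    rw [← Finset.sum_sub_distrib, hD]
    simp only [← sub_smul]
    rw [← Finset.sum_smul, dotProduct_smul, smul_eq_mul]
  -- The sum is `d wᵀ V w = d xᵀ V⁻¹ x`, which the design bounds by `2 d³`.
  have hwp : ∑ i, (w ⬝ᵥ p i) ^ 2 ≤ d * (2 * (d : ℝ) ^ 2) := by
    have e : ∑ i, (w ⬝ᵥ p i) ^ 2 = w ⬝ᵥ (S *ᵥ w) := by
      rw [hS, sum_vecMulVec_mulVec, dotProduct_sum]
      refine Finset.sum_congr rfl fun i _ => ?_
      rw [dotProduct_smul, smul_eq_mul, sq, dotProduct_comm (p i)]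
    rw [e, hSV, Matrix.smul_mulVec, hVw, dotProduct_smul, smul_eq_mul, dotProduct_comm]
    exact mul_le_mul_of_nonneg_left (hV2 x hx) hd'.le
  have hDs : ∑ i, D i ^ 2 ≤ d * (q * β) ^ 2 := by
    calc _ ≤ ∑ _i : Fin d, (q * β) ^ 2 := by
          refine Finset.sum_le_sum fun i _ => ?_
          rw [← sq_abs]
          exact pow_le_pow_left₀ (abs_nonneg _) (hb i) 2
      _ = _ := by simp
  rw [hmain]
  refine abs_le_of_sq_le_sq ?_ (by positivity)
  have hcs := Finset.sum_mul_sq_le_sq_mul_sq Finset.univ D (fun i => w ⬝ᵥ p i)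
  calc _ = ((q * d : ℝ))⁻¹ ^ 2 * (∑ i, D i * (w ⬝ᵥ p i)) ^ 2 := by rw [mul_pow]
    _ ≤ ((q * d : ℝ))⁻¹ ^ 2 * ((d * (q * β) ^ 2) * (d * (2 * (d : ℝ) ^ 2))) := by
      gcongr
      refine hcs.trans ?_
      gcongr
    _ = (Real.sqrt 2 * d * β) ^ 2 := by
      rw [mul_pow (Real.sqrt 2 * d), mul_pow (Real.sqrt 2), Real.sq_sqrt (by norm_num)]
      field_simp

/-- Error of the estimate of one phase, when the row player uses `xb` and its perturbations and
the opponent plays `yb + λ_t ξ_s` in round `s`. -/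
theorem estimate_error {m : ℕ} {X : Set (Fin d → ℝ)} {p : Fin d → Fin d → ℝ} (hd : 1 ≤ d)
    (hp : IsExplorationDesign X p) (A : Matrix (Fin d) (Fin m) ℝ) (ht : 1 ≤ t)
    {r : ℕ → ℝ} {xb : Fin d → ℝ} {yb : Fin m → ℝ} {ξ : ℕ → Fin m → ℝ}
    (hr : ∀ s, r s = payoff A
      (if (c s).1 = true then (1 - mixing t) • xb + mixing t • p (c s).2 else xb)
      (yb + mixing t • ξ s))
    (hES : EnoughSamples δ t c) (hq : 0 < batch δ t / (4 * d)) {β : ℝ}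
    (hβ : ∀ i : Fin d, |∑ j : Fin (batch δ t / (4 * d)),
      (payoff A ((1 - mixing t) • xb + mixing t • p i) (ξ (exploreRound (batch δ t) c i j))
        - (1 - mixing t) * payoff A xb
          (ξ (baseRound (batch δ t) c ((i : ℕ) * (batch δ t / (4 * d)) + j))))|
      ≤ (batch δ t / (4 * d) : ℕ) * β) {x : Fin d → ℝ} (hx : x ∈ X) :
    |x ⬝ᵥ (estimate p δ t c r - A *ᵥ yb)| ≤ Real.sqrt 2 * d * β := by
  rw [estimate, if_pos hES]
  refine least_squares_error hd hp hq _ _ (fun i => ?_) hx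
  refine le_trans (le_of_eq ?_) (hβ i)
  congr 1
  refine Finset.sum_congr rfl fun j _ => ?_
  have hbase : (c (baseRound (batch δ t) c ((i : ℕ) * (batch δ t / (4 * d)) + j))).1 = false :=
    (nth_Icc_mem _ _ (hES.lt_card_base i j)).2
  have hexp : c (exploreRound (batch δ t) c i j) = (true, i) :=
    (nth_Icc_mem _ _ (hES.lt_card_explore i j)).2
  have hl : mixing t ≠ 0 := by
    have : (0 : ℝ) < t := by exact_mod_cast ht
    unfold mixing; positivity
  -- The terms in `xb` against `yb` cancel, and every surviving term carries a factor `λ_t`,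
  -- including those from the opponent's perturbation.
  rw [transformedReward, hr, hr, hexp, hbase]
  simp only [if_true, Bool.false_eq_true, if_false, payoff, Matrix.mulVec_add, Matrix.mulVec_smul,
    dotProduct_add, add_dotProduct, smul_dotProduct, dotProduct_smul, smul_eq_mul]
  field_simp
  ring

end Estimator

/-! ### Hoeffding's inequality and conditioning on discrete variables -/

section Independence

variable {Ω : Type*} [MeasurableSpace Ω] {μ : Measure Ω}

/-- Two-sided Hoeffding inequality for a bounded function of independent variables. -/
theorem measure_abs_sum_sub_ge_le [IsProbabilityMeasure μ] {α ι : Type*} [MeasurableSpace α]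
    {e : ι → Ω → α} (he : ∀ s, Measurable (e s)) (hind : iIndepFun e μ) {g : α → ℝ}
    (hg : Measurable g) {lo w : ℝ} (hw : 0 < w) (hgb : ∀ v, g v ∈ Set.Icc lo (lo + w)) {E : ℝ}
    (hE : ∀ s, ∫ ω, g (e s ω) ∂μ = E) (S : Finset ι) {ε : ℝ} (hε : 0 ≤ ε) :
    μ {ω | S.card * ε ≤ |∑ s ∈ S, g (e s ω) - S.card * E|}
      ≤ ENNReal.ofReal (2 * Real.exp (-(2 * S.card * ε ^ 2 / w ^ 2))) := by
  have hsub : ∀ s, HasSubgaussianMGF (fun ω => g (e s ω) - E) ((‖(lo + w) - lo‖₊ / 2) ^ 2) μ := by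
    intro s
    have := hasSubgaussianMGF_of_mem_Icc (μ := μ) (X := fun ω => g (e s ω))
      (hg.comp (he s)).aemeasurable (ae_of_all _ fun ω => hgb (e s ω))
    rwa [hE s] at this
  have hind1 : iIndepFun (fun s ω => g (e s ω) - E) μ :=
    hind.comp (fun _ v => g v - E) (fun _ => hg.sub_const E)
  have hind2 : iIndepFun (fun s => -(fun ω => g (e s ω) - E)) μ :=
    hind.comp (fun _ v => -(g v - E)) (fun _ => (hg.sub_const E).neg)
  have hc : 0 ≤ (S.card : ℝ) * ε := by positivity
  have h1 := HasSubgaussianMGF.measure_sum_ge_le_of_iIndepFun hind1 (s := S)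
    (fun s _ => hsub s) hc
  have h2 := HasSubgaussianMGF.measure_sum_ge_le_of_iIndepFun hind2 (s := S)
    (fun s _ => (hsub s).neg) hc
  have hexp : -((S.card : ℝ) * ε) ^ 2 / (2 * ((∑ _i ∈ S, (‖(lo + w) - lo‖₊ / 2) ^ 2 : NNReal) : ℝ))
      = -(2 * S.card * ε ^ 2 / w ^ 2) := by
    rcases Nat.eq_zero_or_pos S.card with h0 | h0
    · simp [h0]
    · have h0' : (S.card : ℝ) ≠ 0 := by positivity
      push_cast
      simp only [add_sub_cancel_left, Real.norm_eq_abs, abs_of_pos hw, Finset.sum_const,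
        nsmul_eq_mul]
      field_simp
  rw [hexp] at h1 h2
  have hsubset : {ω | S.card * ε ≤ |∑ s ∈ S, g (e s ω) - S.card * E|}
      ⊆ {ω | S.card * ε ≤ ∑ s ∈ S, (g (e s ω) - E)}
        ∪ {ω | S.card * ε ≤ ∑ s ∈ S, (-(fun ω => g (e s ω) - E)) ω} := by
    intro ω hω
    have hω' : (S.card : ℝ) * ε ≤ |∑ s ∈ S, g (e s ω) - S.card * E| := hω
    have e1 : ∑ s ∈ S, (g (e s ω) - E) = ∑ s ∈ S, g (e s ω) - S.card * E := by
      simp [Finset.sum_sub_distrib]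
    have e2 : ∑ s ∈ S, (-(fun ω => g (e s ω) - E)) ω = -(∑ s ∈ S, g (e s ω) - S.card * E) := by
      simp only [Pi.neg_apply, Finset.sum_neg_distrib, e1]
    rcases le_abs.1 hω' with h | h
    · left; rw [Set.mem_ofPred_eq, e1]; exact h
    · right; rw [Set.mem_ofPred_eq, e2]; exact h
  refine (measure_mono hsubset).trans ((measure_union_le _ _).trans ?_)
  rw [two_mul, ENNReal.ofReal_add (Real.exp_pos _).le (Real.exp_pos _).le]
  refine add_le_add ?_ ?_
  · rw [← ofReal_measureReal]; exact ENNReal.ofReal_le_ofReal h1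
  · rw [← ofReal_measureReal]; exact ENNReal.ofReal_le_ofReal h2

theorem indepFun_of_singleton [IsProbabilityMeasure μ] {α β : Type*} [Countable α] [Countable β]
    [MeasurableSpace α] [MeasurableSpace β] [MeasurableSingletonClass α]
    [MeasurableSingletonClass β] {U : Ω → α} {V : Ω → β} (hU : Measurable U) (hV : Measurable V)
    (h : ∀ a b, μ (U ⁻¹' {a} ∩ V ⁻¹' {b}) = μ (U ⁻¹' {a}) * μ (V ⁻¹' {b})) : IndepFun U V μ := by
  rw [indepFun_iff_map_prod_eq_prod_map_map hU.aemeasurable hV.aemeasurable]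
  refine Measure.ext_of_singleton fun ⟨a, b⟩ => ?_
  have := Measure.isProbabilityMeasure_map hU.aemeasurable (μ := μ)
  have := Measure.isProbabilityMeasure_map hV.aemeasurable (μ := μ)
  rw [Measure.map_apply (hU.prodMk hV) (measurableSet_singleton _), ← Set.singleton_prod_singleton,
    Measure.prod_prod, Measure.map_apply hU (measurableSet_singleton _),
    Measure.map_apply hV (measurableSet_singleton _), ← h]
  rfl

/-- If the pairs `(X j, Y j)` are independent, and each `X j` is independent of `Y j`, then the
tuple of the `X j` is independent of the tuple of the `Y j`. -/
theorem indepFun_pi_pi [IsProbabilityMeasure μ] {ι α β : Type*} [Finite ι] [Countable α]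
    [Countable β] [MeasurableSpace α] [MeasurableSpace β] [MeasurableSingletonClass α]
    [MeasurableSingletonClass β] {X : ι → Ω → α} {Y : ι → Ω → β} (hX : ∀ j, Measurable (X j))
    (hY : ∀ j, Measurable (Y j)) (hXY : ∀ j, IndepFun (X j) (Y j) μ)
    (hind : iIndepFun (fun j ω => (X j ω, Y j ω)) μ) :
    IndepFun (fun ω j => X j ω) (fun ω j => Y j ω) μ := by
  have := Fintype.ofFinite ι
  refine indepFun_of_singleton (measurable_pi_lambda _ hX) (measurable_pi_lambda _ hY) fun a b => ?_
  have e1 : (fun ω j => X j ω) ⁻¹' {a} = ⋂ j, X j ⁻¹' {a j} := by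
    ext ω; simp [funext_iff]
  have e2 : (fun ω j => Y j ω) ⁻¹' {b} = ⋂ j, Y j ⁻¹' {b j} := by
    ext ω; simp [funext_iff]
  have e3 : (⋂ j, X j ⁻¹' {a j}) ∩ (⋂ j, Y j ⁻¹' {b j})
      = ⋂ j, (fun ω => (X j ω, Y j ω)) ⁻¹' {(a j, b j)} := by
    ext ω; simp [Prod.ext_iff, forall_and]
  have hX' : iIndepFun X μ := hind.comp (fun _ => Prod.fst) (fun _ => measurable_fst)
  have hY' : iIndepFun Y μ := hind.comp (fun _ => Prod.snd) (fun _ => measurable_snd)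
  have k1 := hX'.measure_inter_preimage_eq_mul Finset.univ (sets := fun j => {a j})
    (fun j _ => measurableSet_singleton _)
  have k2 := hY'.measure_inter_preimage_eq_mul Finset.univ (sets := fun j => {b j})
    (fun j _ => measurableSet_singleton _)
  have k3 := hind.measure_inter_preimage_eq_mul Finset.univ (sets := fun j => {(a j, b j)})
    (fun j _ => measurableSet_singleton _)
  simp only [Finset.mem_univ, Set.iInter_true] at k1 k2 k3
  rw [e1, e2, e3, k1, k2, k3, ← Finset.prod_mul_distrib]
  refine Finset.prod_congr rfl fun j _ => ?_
  rw [← (hXY j).measure_inter_preimage_eq_mul _ _ (measurableSet_singleton _)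
    (measurableSet_singleton _)]
  congr 1
  ext ω; simp [Prod.ext_iff]

/-- The joint law of the three variables splits off `U` first and then separates `V` from `W`. It
merges the past with the player's own coins. -/
theorem indepFun_prodMk_left [IsProbabilityMeasure μ] {α β γ : Type*} [Countable α]
    [Countable β] [Countable γ] [MeasurableSpace α] [MeasurableSpace β] [MeasurableSpace γ]
    [MeasurableSingletonClass α] [MeasurableSingletonClass β] [MeasurableSingletonClass γ]
    {U : Ω → α} {V : Ω → β} {W : Ω → γ} (hU : Measurable U) (hV : Measurable V)
    (hW : Measurable W) (h1 : IndepFun U (fun ω => (V ω, W ω)) μ) (h2 : IndepFun V W μ) :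
    IndepFun (fun ω => (U ω, V ω)) W μ := by
  refine indepFun_of_singleton (hU.prodMk hV) hW fun ⟨a, b⟩ w => ?_
  have e1 : (fun ω => (U ω, V ω)) ⁻¹' {(a, b)} = U ⁻¹' {a} ∩ V ⁻¹' {b} := by
    ext ω; simp [Prod.ext_iff]
  have e2 : U ⁻¹' {a} ∩ V ⁻¹' {b} ∩ W ⁻¹' {w}
      = U ⁻¹' {a} ∩ (fun ω => (V ω, W ω)) ⁻¹' {(b, w)} := by
    ext ω; simp [Prod.ext_iff, and_assoc]
  have e3 : (fun ω => (V ω, W ω)) ⁻¹' {(b, w)} = V ⁻¹' {b} ∩ W ⁻¹' {w} := by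
    ext ω; simp [Prod.ext_iff]
  have h3 : IndepFun U V μ := h1.comp measurable_id measurable_fst
  rw [e1, e2, h1.measure_inter_preimage_eq_mul _ _ (measurableSet_singleton _)
    (measurableSet_singleton _), e3, h2.measure_inter_preimage_eq_mul _ _
    (measurableSet_singleton _) (measurableSet_singleton _),
    h3.measure_inter_preimage_eq_mul _ _ (measurableSet_singleton _) (measurableSet_singleton _),
    mul_assoc]

/-- If on each fibre of `U` the set `s` is covered by a set of measure at most `p` that is
determined by a variable independent of `U`, then `s` has measure at most `p`. -/
theorem measure_le_of_fiber [IsProbabilityMeasure μ] {α β : Type*} [Countable α] [Countable β]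
    [MeasurableSpace α] [MeasurableSpace β] [MeasurableSingletonClass α]
    [MeasurableSingletonClass β] {U : Ω → α} {V : Ω → β} (hU : Measurable U)
    (hUV : IndepFun U V μ) {s : Set Ω} {p : ENNReal}
    (h : ∀ ω₀, ∃ S : Set Ω, (∀ ω ω', V ω = V ω' → ω ∈ S → ω' ∈ S) ∧
      (∀ ω ∈ s, U ω = U ω₀ → ω ∈ S) ∧ μ S ≤ p) : μ s ≤ p := by
  -- Law of total probability over the countably many values of `U`: `S` is a preimage under `V`,
  -- hence independent of each fibre. The set `s` itself need not be measurable.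
  have hfib : ∀ a, μ (s ∩ U ⁻¹' {a}) ≤ p * μ (U ⁻¹' {a}) := by
    intro a
    rcases (s ∩ U ⁻¹' {a}).eq_empty_or_nonempty with h0 | ⟨ω₀, -, h0⟩
    · simp [h0]
    obtain ⟨S, hS1, hS2, hS3⟩ := h ω₀
    have hS : S = V ⁻¹' (V '' S) := by
      refine Set.Subset.antisymm (Set.subset_preimage_image _ _) ?_
      rintro ω ⟨ω', hω', he⟩
      exact hS1 _ _ he hω'
    have h0' : U ω₀ = a := h0
    calc μ (s ∩ U ⁻¹' {a}) ≤ μ (U ⁻¹' {a} ∩ V ⁻¹' (V '' S)) := by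
          refine measure_mono fun ω hω => ⟨hω.2, ?_⟩
          rw [← hS]
          exact hS2 ω hω.1 (by rw [h0']; exact hω.2)
      _ = μ (U ⁻¹' {a}) * μ S := by
          rw [hUV.measure_inter_preimage_eq_mul _ _ (measurableSet_singleton _)
            (Set.to_countable _).measurableSet, ← hS]
      _ ≤ p * μ (U ⁻¹' {a}) := by rw [mul_comm]; gcongr
  calc μ s ≤ μ (⋃ a, s ∩ U ⁻¹' {a}) := measure_mono fun ω hω => by simpa using hω
    _ ≤ ∑' a, μ (s ∩ U ⁻¹' {a}) := measure_iUnion_le _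
    _ ≤ ∑' a, p * μ (U ⁻¹' {a}) := ENNReal.tsum_le_tsum hfib
    _ = p * ∑' a, μ (U ⁻¹' {a}) := ENNReal.tsum_mul_left
    _ = p * μ (⋃ a, U ⁻¹' {a}) := by
        rw [measure_iUnion]
        · intro a b hab
          exact Set.disjoint_left.2 fun ω h1 h2 => hab (h1.symm.trans h2)
        · exact fun a => hU (measurableSet_singleton _)
    _ ≤ p * 1 := by gcongr; exact prob_le_one
    _ = p := mul_one p

end Independence

/-! ### Laws and independence of the coins -/

section FairCoins

variable {Ω : Type*} [MeasurableSpace Ω] {μ : Measure Ω} {n m : ℕ}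
  {c : ℕ → ℕ → Ω → Coin n} {e : ℕ → ℕ → Ω → Coin m}

theorem FairCoins.swap (h : FairCoins μ c e) : FairCoins μ e c where
  measurable_row := h.measurable_col
  measurable_col := h.measurable_row
  law_row := h.law_col
  law_col := h.law_row
  indep_players t s := (h.indep_players t s).symm
  indep_rounds := h.indep_rounds.comp (fun _ => Prod.swap) (fun _ => measurable_swap)

theorem integral_coin [IsProbabilityMeasure μ] (h : FairCoins μ c e) (g : Coin m → ℝ)
    (t s : ℕ) :
    ∫ ω, g (e t s ω) ∂μ = ∑ v, g v / (2 * m) := by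
  have hmeas := h.measurable_col t s
  have := Measure.isProbabilityMeasure_map hmeas.aemeasurable (μ := μ)
  rw [← integral_map (φ := e t s) hmeas.aemeasurable
    (measurable_of_countable g).aestronglyMeasurable, integral_fintype (.of_finite)]
  refine Finset.sum_congr rfl fun v _ => ?_
  have : (μ.map (e t s)).real {v} = (2 * (m : ℝ))⁻¹ := by
    have h3 := h.law_col t s v
    rw [measureReal_def, Measure.map_apply hmeas (measurableSet_singleton _)]
    change (μ {ω | e t s ω = v}).toReal = _
    rw [h3, ENNReal.toReal_inv]
    simp
  rw [this, smul_eq_mul]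
  ring

theorem iIndepFun_col (h : FairCoins μ c e) (t : ℕ) : iIndepFun (fun s => e t s) μ := by
  have h1 : iIndepFun (fun i : ℕ × ℕ => e i.1 i.2) μ :=
    h.indep_rounds.comp (fun _ => Prod.snd) (fun _ => measurable_snd)
  exact h1.precomp (g := fun s : ℕ => (t, s)) (fun a b hab => (Prod.ext_iff.1 hab).2)

/-- The coins of both players in the rounds of `I` and the row player's coins in the rounds of `J`
are independent of the column player's coins in the rounds of `J`. -/
theorem FairCoins.indepFun_history [IsProbabilityMeasure μ] (h : FairCoins μ c e)
    {I J : Finset (ℕ × ℕ)} (hIJ : Disjoint I J) :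
    IndepFun (fun ω => ((fun i : I => (c i.1.1 i.1.2 ω, e i.1.1 i.1.2 ω)),
      (fun j : J => c j.1.1 j.1.2 ω))) (fun ω (j : J) => e j.1.1 j.1.2 ω) μ := by
  have hmeas : ∀ i : ℕ × ℕ, Measurable fun ω => (c i.1 i.2 ω, e i.1 i.2 ω) := fun i =>
    (h.measurable_row _ _).prodMk (h.measurable_col _ _)
  refine indepFun_prodMk_left (measurable_pi_lambda _ fun i => hmeas i)
    (measurable_pi_lambda _ fun j => h.measurable_row _ _)
    (measurable_pi_lambda _ fun j => h.measurable_col _ _) ?_ ?_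
  · have := h.indep_rounds.indepFun_finset I J hIJ hmeas
    exact this.comp (φ := id) (ψ := fun x : J → Coin n × Coin m => (fun j => (x j).1, fun j => (x j).2))
      measurable_id (by fun_prop)
  · exact indepFun_pi_pi (fun j => h.measurable_row _ _) (fun j => h.measurable_col _ _)
      (fun j => h.indep_players _ _) (h.indep_rounds.precomp Subtype.val_injective)

end FairCoins

/-! ### What the earlier coins determine -/

section History

theorem baseRound_le {d : ℕ} (B : ℕ) (c : ℕ → Coin d) (j : ℕ) : baseRound B c j ≤ B :=
  nth_Icc_le _ _ _

theorem exploreRound_le {d : ℕ} (B : ℕ) (c : ℕ → Coin d) (i : Fin d) (j : ℕ) :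
    exploreRound B c i j ≤ B :=
  nth_Icc_le _ _ _

theorem baseRound_congr {d B : ℕ} {c c' : ℕ → Coin d} (hc : ∀ s ≤ B, c s = c' s) (j : ℕ) :
    baseRound B c j = baseRound B c' j := by
  unfold baseRound
  congr 1
  funext s
  exact propext (and_congr_right fun hs => by rw [hc s (Finset.mem_Icc.1 hs).2])

theorem exploreRound_congr {d B : ℕ} {c c' : ℕ → Coin d} (hc : ∀ s ≤ B, c s = c' s) (i : Fin d)
    (j : ℕ) : exploreRound B c i j = exploreRound B c' i j := by
  unfold exploreRound
  congr 1
  funext s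
  exact propext (and_congr_right fun hs => by rw [hc s (Finset.mem_Icc.1 hs).2])

theorem EnoughSamples.congr {d : ℕ} {δ : ℝ} {t : ℕ} {c c' : ℕ → Coin d}
    (hc : ∀ s ≤ batch δ t, c s = c' s) : EnoughSamples δ t c ↔ EnoughSamples δ t c' := by
  have e1 : (Finset.Icc 1 (batch δ t)).filter (fun s => (c s).1 = false)
      = (Finset.Icc 1 (batch δ t)).filter (fun s => (c' s).1 = false) :=
    Finset.filter_congr fun s hs => by rw [hc s (Finset.mem_Icc.1 hs).2]
  have e2 : ∀ i, (Finset.Icc 1 (batch δ t)).filter (fun s => c s = (true, i))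
      = (Finset.Icc 1 (batch δ t)).filter (fun s => c' s = (true, i)) := fun i =>
    Finset.filter_congr fun s hs => by rw [hc s (Finset.mem_Icc.1 hs).2]
  simp only [EnoughSamples, e1, e2]

theorem estimate_congr {d : ℕ} (p : Fin d → Fin d → ℝ) {δ : ℝ} {t : ℕ} {c c' : ℕ → Coin d}
    {r r' : ℕ → ℝ} (hc : ∀ s ≤ batch δ t, c s = c' s) (hr : ∀ s ≤ batch δ t, r s = r' s) :
    estimate p δ t c r = estimate p δ t c' r' := by
  have hE : EnoughSamples δ t c ↔ EnoughSamples δ t c' := EnoughSamples.congr hc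
  have ht : ∀ i j k, transformedReward t r (baseRound (batch δ t) c' k)
      (exploreRound (batch δ t) c' i j) = transformedReward t r' (baseRound (batch δ t) c' k)
      (exploreRound (batch δ t) c' i j) := by
    intro i j k
    rw [transformedReward, transformedReward, hr _ (exploreRound_le _ _ _ _),
      hr _ (baseRound_le _ _ _)]
  simp only [estimate, baseRound_congr hc, exploreRound_congr hc, ht]
  by_cases h : EnoughSamples δ t c'
  · rw [if_pos (hE.2 h), if_pos h]
  · rw [if_neg (mt hE.1 h), if_neg h]

/-- The coins and rewards act on the average only through the estimates of the earlier phases. -/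
theorem Learner.average_congr {d : ℕ} (P : Learner d) {c c' : ℕ → ℕ → Coin d} {r r' : ℕ → ℕ → ℝ}
    {t : ℕ} (h : ∀ l < t, P.thetaHat c r l = P.thetaHat c' r' l) :
    P.average c r t = P.average c' r' t := by
  have hu : ∀ l < t, P.utilityHat c r l = P.utilityHat c' r' l := fun l hl => by
    rw [utilityHat, utilityHat, h l hl, h (l - 1) (by omega)]
  have ho : ∀ l ≤ t, P.oftrl c r l = P.oftrl c' r' l := by
    intro l hl
    rcases l with _ | _ | l
    · rw [oftrl, oftrl]
    · rw [oftrl, oftrl]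
    · have hs : ∑ k ∈ Finset.Icc 1 (l + 1), P.utilityHat c r k
          = ∑ k ∈ Finset.Icc 1 (l + 1), P.utilityHat c' r' k :=
        Finset.sum_congr rfl fun k hk => hu k (by have := (Finset.mem_Icc.1 hk).2; omega)
      rw [oftrl, oftrl, hs, hu (l + 1) (by omega)]
  rw [average, average, Finset.sum_congr rfl fun l hl => ho l (Finset.mem_Icc.1 hl).2]

variable {n m : ℕ} (P : Learner n) (Q : Learner m) (A : Matrix (Fin n) (Fin m) ℝ)

/-- The averages of phase `t` depend only on the coins of the rounds of the earlier phases. -/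
theorem average_reward_congr (hδ : Q.δ = P.δ) {c c' : ℕ → ℕ → Coin n} {e e' : ℕ → ℕ → Coin m}
    (t : ℕ) (hc : ∀ l < t, ∀ s ≤ batch P.δ l, c l s = c' l s)
    (he : ∀ l < t, ∀ s ≤ batch P.δ l, e l s = e' l s) :
    P.average c (reward P Q A c e) t = P.average c' (reward P Q A c' e') t ∧
      Q.average e (-reward P Q A c e) t = Q.average e' (-reward P Q A c' e') t := by
  induction t using Nat.strong_induction_on with
  | _ t ih =>
    have hr : ∀ l < t, ∀ s ≤ batch P.δ l, reward P Q A c e l s = reward P Q A c' e' l s := by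
      intro l hl s hs
      obtain ⟨h1, h2⟩ := ih l hl (fun k hk => hc k (hk.trans hl)) (fun k hk => he k (hk.trans hl))
      simp only [reward_eq, rowPlay, colPlay, Learner.play, h1, h2, hc l hl s hs, he l hl s hs]
    constructor
    · refine P.average_congr fun l hl => ?_
      rcases l with _ | l
      · rw [Learner.thetaHat, Learner.thetaHat]
      · rw [Learner.thetaHat, Learner.thetaHat]
        exact estimate_congr _ (hc _ hl) (hr _ hl)
    · refine Q.average_congr fun l hl => ?_
      rcases l with _ | l
      · rw [Learner.thetaHat, Learner.thetaHat]
      · rw [Learner.thetaHat, Learner.thetaHat]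
        refine estimate_congr _ (by rw [hδ]; exact he _ hl) ?_
        rw [hδ]
        intro s hs
        rw [Pi.neg_apply, Pi.neg_apply, Pi.neg_apply, Pi.neg_apply, hr _ hl s hs]

end History

/-! ### Enough samples with high probability -/

section Sampling

variable {Ω : Type*} [MeasurableSpace Ω] {μ : Measure Ω} {n m : ℕ}
  {c : ℕ → ℕ → Ω → Coin n} {e : ℕ → ℕ → Ω → Coin m} {δ : ℝ}

/-- The perturbation direction of a player with average `yb`. -/
def perturbation {m : ℕ} (q : Fin m → Fin m → ℝ) (yb : Fin m → ℝ) (v : Coin m) : Fin m → ℝ :=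
  if v.1 = true then q v.2 - yb else 0

/-- The thresholds are half the expected counts, so Hoeffding's inequality applies with deviations
`1/4` and `1/(4n)`. The latter gives exponent `B/(8 n²)`, and the factor `32` in the sample
condition makes this at least `4 L`. -/
theorem measure_not_enoughSamples_le [IsProbabilityMeasure μ] (h : FairCoins μ c e) (hn : 1 ≤ n)
    (hδ₀ : 0 < δ) (hδ₁ : δ ≤ 1 / 2) {t : ℕ} (ht : 1 ≤ t)
    (hB : 32 * (n : ℝ) ^ 2 * Real.log (8 * (t : ℝ) ^ 2 / δ) ≤ batch δ t) :
    μ {ω | ¬ EnoughSamples δ t fun s => c t s ω}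
      ≤ (1 + n) * ENNReal.ofReal (2 * Real.exp (-(4 * Real.log (8 * (t : ℝ) ^ 2 / δ)))) := by
  have hL := two_lt_log_phase hδ₀ hδ₁ ht
  set L := Real.log (8 * (t : ℝ) ^ 2 / δ)
  set B := batch δ t
  have hn' : (1 : ℝ) ≤ n := by exact_mod_cast hn
  have hind := iIndepFun_col h.swap t
  have hcard : ((Finset.Icc 1 B).card : ℝ) = B := by simp
  have hmono : ∀ x : ℝ, 4 * L ≤ x → ENNReal.ofReal (2 * Real.exp (-x))
      ≤ ENNReal.ofReal (2 * Real.exp (-(4 * L))) := fun x hx =>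
    ENNReal.ofReal_le_ofReal (by gcongr)
  have hcount : ∀ (a : Coin n → Prop) [DecidablePred a] (E ε : ℝ), 0 ≤ ε →
      (∑ v, (if a v then (1 : ℝ) else 0) / (2 * n) = E) → 4 * L ≤ 2 * B * ε ^ 2 →
      μ {ω | (((Finset.Icc 1 B).filter fun s => a (c t s ω)).card : ℝ) ≤ B * (E - ε)}
        ≤ ENNReal.ofReal (2 * Real.exp (-(4 * L))) := by
    intro a _ E ε hε hE hLε
    have hh := measure_abs_sum_sub_ge_le (fun s => h.measurable_row t s) hind
      (g := fun v => if a v then (1 : ℝ) else 0) (measurable_of_countable _) (lo := 0) (w := 1)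
      one_pos (fun v => by split_ifs <;> simp) (E := E)
      (fun s => (integral_coin h.swap _ t s).trans hE) (Finset.Icc 1 B) hε
    rw [hcard] at hh
    refine le_trans (measure_mono fun ω hω => ?_) (hh.trans (hmono _ (by simpa using hLε)))
    rw [Set.mem_ofPred_eq] at hω ⊢
    rw [Finset.sum_boole, le_abs]
    right
    linarith
  have hsub : {ω | ¬ EnoughSamples δ t fun s => c t s ω}
      ⊆ {ω | (((Finset.Icc 1 B).filter fun s => (c t s ω).1 = false).card : ℝ) ≤ B * (1 / 2 - 1 / 4)}
        ∪ ⋃ i : Fin n, {ω | (((Finset.Icc 1 B).filter fun s => c t s ω = (true, i)).card : ℝ)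
          ≤ B * (1 / (2 * n) - 1 / (4 * n))} := by
    intro ω hω
    by_contra hcon
    rw [Set.mem_union, Set.mem_iUnion, not_or, not_exists] at hcon
    obtain ⟨h1, h2⟩ := hcon
    refine hω ⟨hB, ?_, fun i => ?_⟩
    · rw [Set.mem_ofPred_eq, not_le] at h1
      linarith
    · have := h2 i
      rw [Set.mem_ofPred_eq, not_le] at this
      refine le_of_eq_of_le ?_ this.le
      field_simp
      ring
  refine (measure_mono hsub).trans ((measure_union_le _ _).trans ?_)
  rw [add_mul, one_mul]
  refine add_le_add ?_ ((measure_iUnion_fintype_le _ _).trans ?_)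
  · refine hcount (fun v => v.1 = false) (1 / 2) (1 / 4) (by norm_num) ?_ ?_
    · rw [Fintype.sum_prod_type]
      simp
      field_simp
    · nlinarith [mul_nonneg (sub_nonneg.2 (one_le_pow₀ hn' : (1 : ℝ) ≤ (n : ℝ) ^ 2)) (by linarith : (0 : ℝ) ≤ L)]
  · refine (Finset.sum_le_sum fun i _ => hcount (fun v => v = (true, i)) (1 / (2 * n)) (1 / (4 * n))
      (by positivity) ?_ ?_).trans (by simp)
    · rw [← Finset.sum_div]; simp
    · have : 2 * (B : ℝ) * (1 / (4 * n)) ^ 2 = B / (8 * n ^ 2) := by field_simp; ring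
      rw [this, le_div_iff₀ (by positivity)]
      linarith

end Sampling

/-! ### Accuracy of the estimate in one phase -/

section Concentration

variable {Ω : Type*} [MeasurableSpace Ω] {μ : Measure Ω} {n m : ℕ}
  {c : ℕ → ℕ → Ω → Coin n} {e : ℕ → ℕ → Ω → Coin m}

theorem perturbation_payoff_mem {X : Set (Fin n → ℝ)} {Y : Set (Fin m → ℝ)}
    {A : Matrix (Fin n) (Fin m) ℝ} (hA : ∀ x ∈ X, ∀ y ∈ Y, payoff A x y ∈ Set.Icc (-1 : ℝ) 1)
    {q : Fin m → Fin m → ℝ} (hq : ∀ j, q j ∈ Y) {yb : Fin m → ℝ} (hyb : yb ∈ Y)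
    {x : Fin n → ℝ} (hx : x ∈ X) (v : Coin m) :
    payoff A x (perturbation q yb v) ∈ Set.Icc (-2 : ℝ) (-2 + 4) := by
  have h1 := hA x hx yb hyb
  have h2 := hA x hx _ (hq v.2)
  rw [Set.mem_Icc] at h1 h2
  unfold perturbation
  split_ifs
  · have : payoff A x (q v.2 - yb) = payoff A x (q v.2) - payoff A x yb := by
      simp [payoff, Matrix.mulVec_sub]
    rw [this]
    constructor <;> linarith [h1.1, h1.2, h2.1, h2.2]
  · simp [payoff]; norm_num

/-- Concentration of sums of payoffs against the perturbations of the column player. -/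
theorem measure_payoff_perturbation_le [IsProbabilityMeasure μ] (h : FairCoins μ c e)
    {X : Set (Fin n → ℝ)} {Y : Set (Fin m → ℝ)}
    {A : Matrix (Fin n) (Fin m) ℝ} (hA : ∀ x ∈ X, ∀ y ∈ Y, payoff A x y ∈ Set.Icc (-1 : ℝ) 1)
    {q : Fin m → Fin m → ℝ} (hq : ∀ j, q j ∈ Y) {yb : Fin m → ℝ} (hyb : yb ∈ Y)
    {x : Fin n → ℝ} (hx : x ∈ X) (t : ℕ) {N : ℕ} {s : Fin N → ℕ} (hs : Function.Injective s)
    {ε : ℝ} (hε : 0 ≤ ε) :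
    μ {ω | N * ε ≤ |∑ j, payoff A x (perturbation q yb (e t (s j) ω))
        - N * ∑ v, payoff A x (perturbation q yb v) / (2 * m)|}
      ≤ ENNReal.ofReal (2 * Real.exp (-(N * ε ^ 2 / 8))) := by
  have hh := measure_abs_sum_sub_ge_le (e := fun j => e t (s j))
    (fun j => h.measurable_col t (s j)) ((iIndepFun_col h t).precomp hs)
    (g := fun v => payoff A x (perturbation q yb v)) (measurable_of_countable _) (lo := -2)
    (w := 4) (by norm_num) (perturbation_payoff_mem hA hq hyb hx)
    (fun j => integral_coin h (fun v => payoff A x (perturbation q yb v)) t (s j)) Finset.univ hε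
  simp only [Finset.card_univ, Fintype.card_fin] at hh
  refine hh.trans (le_of_eq ?_)
  congr 4
  ring

/-- The perturbation is not centred. Its mean affects the estimate only with a factor `λ_t`, so a
crude bound is enough. -/
theorem abs_mean_payoff_perturbation_le (hm : 1 ≤ m)
    {X : Set (Fin n → ℝ)} {Y : Set (Fin m → ℝ)}
    {A : Matrix (Fin n) (Fin m) ℝ} (hA : ∀ x ∈ X, ∀ y ∈ Y, payoff A x y ∈ Set.Icc (-1 : ℝ) 1)
    {q : Fin m → Fin m → ℝ} (hq : ∀ j, q j ∈ Y) {yb : Fin m → ℝ} (hyb : yb ∈ Y)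
    {x : Fin n → ℝ} (hx : x ∈ X) :
    |∑ v, payoff A x (perturbation q yb v) / (2 * m)| ≤ 2 := by
  have hm' : (0 : ℝ) < m := by exact_mod_cast hm
  refine (Finset.abs_sum_le_sum_abs _ _).trans ?_
  calc _ ≤ ∑ _v : Coin m, 2 / (2 * (m : ℝ)) := by
        refine Finset.sum_le_sum fun v _ => ?_
        have := perturbation_payoff_mem hA hq hyb hx v
        rw [Set.mem_Icc] at this
        rw [abs_div, abs_of_pos (by positivity : (0 : ℝ) < 2 * m)]
        gcongr
        rw [abs_le]
        constructor <;> linarith [this.1, this.2]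
    _ = 2 := by simp; field_simp

variable {P : Learner n} {Q : Learner m} {A : Matrix (Fin n) (Fin m) ℝ}

theorem pow_three_lt_of_batch_lt {δ : ℝ} (hδ₀ : 0 < δ) (hδ₁ : δ ≤ 1 / 2) {t : ℕ} (ht : 1 ≤ t)
    (hB : ¬ 32 * (n : ℝ) ^ 2 * Real.log (8 * (t : ℝ) ^ 2 / δ) ≤ batch δ t) :
    (t : ℝ) ^ 3 < 32 * n ^ 2 := by
  have hL := two_lt_log_phase hδ₀ hδ₁ ht
  have h1 := le_batch δ t
  push Not at hB
  by_contra hcon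
  push Not at hcon
  nlinarith

/-- The numerical parameters of a phase that has enough rounds. -/
theorem phase_parameters {δ : ℝ} (hn : 1 ≤ n) (hδ₀ : 0 < δ) (hδ₁ : δ ≤ 1 / 2) {t : ℕ} (ht : 1 ≤ t)
    (hB : 32 * (n : ℝ) ^ 2 * Real.log (8 * (t : ℝ) ^ 2 / δ) ≤ batch δ t) :
    0 < batch δ t / (4 * n) ∧ ∃ ε : ℝ, 0 ≤ ε ∧
      (batch δ t / (4 * n) : ℕ) * ε ^ 2 / 8 = 4 * Real.log (8 * (t : ℝ) ^ 2 / δ) ∧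
      Real.sqrt 2 * n * (2 * ε + 2 * mixing t) ≤ Real.sqrt (2500 * n ^ 3 / t ^ 3) := by
  have hL := two_lt_log_phase hδ₀ hδ₁ ht
  have hlow := le_batch δ t
  set L := Real.log (8 * (t : ℝ) ^ 2 / δ)
  set B := batch δ t
  have hn' : (1 : ℝ) ≤ n := by exact_mod_cast hn
  have ht' : (1 : ℝ) ≤ t := by exact_mod_cast ht
  have hBn : (8 : ℝ) * n ≤ B := by nlinarith [mul_nonneg (sub_nonneg.2 hn') (by linarith : (0 : ℝ) ≤ n)]
  have hq : (B : ℝ) / (8 * n) ≤ (B / (4 * n) : ℕ) := by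
    have h1 : (B : ℝ) / (4 * n) < (B / (4 * n) : ℕ) + 1 := by
      have := Nat.lt_floor_add_one ((B : ℝ) / ((4 * n : ℕ) : ℝ))
      rw [Nat.floor_div_eq_div] at this
      push_cast at this
      exact this
    have h2 : (1 : ℝ) ≤ B / (8 * n) := by rw [le_div_iff₀ (by positivity)]; linarith
    have h3 : (B : ℝ) / (4 * n) = 2 * (B / (8 * n)) := by field_simp; ring
    linarith
  set q := B / (4 * n)
  have hq0 : (0 : ℝ) < q := lt_of_lt_of_le (div_pos (by linarith) (by positivity)) hq
  -- The value `ε² = 32 L / q` makes the Hoeffding exponent `q ε² / 8` equal to `4 L`.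
  refine ⟨by exact_mod_cast hq0, Real.sqrt (32 * L / q), Real.sqrt_nonneg _, ?_, ?_⟩
  · rw [Real.sq_sqrt (by positivity)]
    field_simp
    ring
  -- In units of `a`, `ε ≤ 16 a` and `λ_t ≤ a`; then `1.42 * 34 ≤ 50`, and `50² = 2500`.
  · set a := Real.sqrt (n / t ^ 3) with ha
    have ha0 : 0 ≤ a := Real.sqrt_nonneg _
    have hε : Real.sqrt (32 * L / q) ≤ 16 * a := by
      rw [ha, ← Real.sqrt_sq (by norm_num : (0 : ℝ) ≤ 16), ← Real.sqrt_mul (by norm_num)]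
      apply Real.sqrt_le_sqrt
      rw [mul_div_assoc', div_le_div_iff₀ hq0 (by positivity)]
      have h4 : L * t ^ 3 ≤ 8 * n * q := by
        refine hlow.trans ?_
        rw [div_le_iff₀ (by positivity)] at hq
        linarith
      nlinarith
    have hl : mixing t ≤ a := by
      rw [ha]
      apply Real.le_sqrt_of_sq_le
      rw [mixing, div_pow, one_pow, div_le_div_iff₀ (by positivity) (by positivity)]
      have : (t : ℝ) ^ 3 ≤ (t ^ 2) ^ 2 := by
        rw [← pow_mul]; exact pow_le_pow_right₀ ht' (by norm_num)
      nlinarith [(by positivity : (0 : ℝ) ≤ (t ^ 2) ^ 2)]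
    have h2 : Real.sqrt 2 ≤ 1.42 := by
      rw [Real.sqrt_le_left (by norm_num)]; norm_num
    have hs : Real.sqrt (2500 * n ^ 3 / t ^ 3) = 50 * n * a := by
      rw [ha, show (2500 : ℝ) * n ^ 3 / t ^ 3 = (50 * n) ^ 2 * (n / t ^ 3) by ring,
        Real.sqrt_mul (by positivity), Real.sqrt_sq (by positivity)]
    rw [hs]
    have hm0 := mixing_nonneg t
    calc _ ≤ 1.42 * n * (2 * (16 * a) + 2 * a) := by gcongr
      _ ≤ _ := by nlinarith [(by positivity : (0 : ℝ) ≤ n * a)]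

/-- The exponential is `(δ / (8 t²))⁴`. A phase long enough for sampling has `n ≤ t³`, so the spare
powers of `t` absorb the factor `n` coming from the union bound. -/
theorem failure_probability_le {δ : ℝ} (hn : 1 ≤ n) (hδ₀ : 0 < δ) (hδ₁ : δ ≤ 1 / 2) {t : ℕ}
    (ht : 1 ≤ t) (hB : 32 * (n : ℝ) ^ 2 * Real.log (8 * (t : ℝ) ^ 2 / δ) ≤ batch δ t) :
    8 * n * Real.exp (-(4 * Real.log (8 * (t : ℝ) ^ 2 / δ))) ≤ δ / (4 * t ^ 2) := by
  have hL := two_lt_log_phase hδ₀ hδ₁ ht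
  have hup := batch_le hδ₀ hδ₁ ht
  have hn' : (1 : ℝ) ≤ n := by exact_mod_cast hn
  have ht' : (1 : ℝ) ≤ t := by exact_mod_cast ht
  have hnt : (n : ℝ) ≤ t ^ 3 := by
    by_contra hcon
    push Not at hcon
    have h1 : (n : ℝ) ≤ n ^ 2 := by nlinarith
    have h2 : 32 * (n : ℝ) ^ 2 ≤ 2 * t ^ 3 := by
      by_contra hc2
      push Not at hc2
      nlinarith
    have h3 : (0 : ℝ) ≤ t ^ 3 := by positivity
    linarith
  have hexp : Real.exp (-(4 * Real.log (8 * (t : ℝ) ^ 2 / δ))) = (δ / (8 * t ^ 2)) ^ 4 := by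
    rw [show -(4 * Real.log (8 * (t : ℝ) ^ 2 / δ)) = ((4 : ℕ) : ℝ) * (-Real.log (8 * (t : ℝ) ^ 2 / δ)) by
      push_cast; ring, Real.exp_nat_mul, Real.exp_neg, Real.exp_log (by positivity), inv_div]
  rw [hexp]
  have e : 8 * n * (δ / (8 * t ^ 2)) ^ 4 = δ / (4 * t ^ 2) * (n * δ ^ 3 / (128 * t ^ 6)) := by
    field_simp; ring
  rw [e]
  refine mul_le_of_le_one_right (by positivity) ?_
  rw [div_le_one (by positivity)]
  have h6 : (t : ℝ) ^ 3 ≤ t ^ 6 := pow_le_pow_right₀ ht' (by norm_num)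
  have h7 : δ ^ 3 ≤ 1 := pow_le_one₀ hδ₀.le (by linarith)
  have : (n : ℝ) * δ ^ 3 ≤ n * 1 := by gcongr
  have : (0 : ℝ) ≤ t ^ 6 := by positivity
  linarith

/-- In each phase the estimate of the row player is accurate with high probability. -/
theorem measure_error_le [IsProbabilityMeasure μ] (h : FairCoins μ c e) (hP : P.Admissible)
    (hQ : Q.Admissible) (hA : ∀ x ∈ P.X, ∀ y ∈ Q.X, payoff A x y ∈ Set.Icc (-1 : ℝ) 1)
    (hδ : Q.δ = P.δ) (hδ₀ : 0 < P.δ) (hδ₁ : P.δ ≤ 1 / 2) {t : ℕ} (ht : 1 ≤ t) :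
    μ {ω | ¬ ∀ z ∈ P.X, |z ⬝ᵥ (P.thetaHat (fun t s => c t s ω)
        (reward P Q A (fun t s => c t s ω) (fun t s => e t s ω)) t
        - A *ᵥ Q.average (fun t s => e t s ω)
          (-reward P Q A (fun t s => c t s ω) (fun t s => e t s ω)) t)|
        ≤ Real.sqrt (2500 * n ^ 3 / t ^ 3)}
      ≤ ENNReal.ofReal (P.δ / (4 * t ^ 2)) := by
  have hn' : (1 : ℝ) ≤ n := by exact_mod_cast hP.one_le
  have ht' : (1 : ℝ) ≤ t := by exact_mod_cast ht
  set C : Ω → ℕ → ℕ → Coin n := fun ω t s => c t s ω with hC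
  set E : Ω → ℕ → ℕ → Coin m := fun ω t s => e t s ω with hE
  set R : Ω → ℕ → ℕ → ℝ := fun ω => reward P Q A (C ω) (E ω) with hR
  set xb : Ω → Fin n → ℝ := fun ω => P.average (C ω) (R ω) t with hxb
  set yb : Ω → Fin m → ℝ := fun ω => Q.average (E ω) (-R ω) t with hyb
  have hxm : ∀ ω, xb ω ∈ P.X := fun ω => hP.average_mem _ _ ht
  have hym : ∀ ω, yb ω ∈ Q.X := fun ω => hQ.average_mem _ _ ht
  set good : Ω → Prop := fun ω => ∀ z ∈ P.X, |z ⬝ᵥ (P.thetaHat (C ω) (R ω) t - A *ᵥ yb ω)|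
        ≤ Real.sqrt (2500 * n ^ 3 / t ^ 3) with hgood
  change μ {ω | ¬ good ω} ≤ _
  have hθ : ∀ ω, P.thetaHat (C ω) (R ω) t = estimate P.p P.δ t (C ω t) (R ω t) := by
    intro ω
    obtain ⟨k, rfl⟩ : ∃ k, t = k + 1 := ⟨t - 1, by omega⟩
    rw [Learner.thetaHat]
  by_cases hB : 32 * (n : ℝ) ^ 2 * Real.log (8 * (t : ℝ) ^ 2 / P.δ) ≤ batch P.δ t
  swap
  -- In a phase that is too short the estimate is `0` and the error at most one, while `t³ < 32 n²`
  -- makes the claimed bound at least one.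
  · have hall : ∀ ω, good ω := by
      intro ω z hz
      have : ¬ EnoughSamples P.δ t (C ω t) := fun hES => hB hES.1
      rw [hθ, estimate]
      simp only [this, if_false, zero_sub, dotProduct_neg, abs_neg]
      refine (abs_le.2 (hA z hz _ (hym ω))).trans ?_
      rw [Real.one_le_sqrt, le_div_iff₀ (by positivity)]
      have := pow_three_lt_of_batch_lt hδ₀ hδ₁ ht hB
      have h3 : (n : ℝ) ^ 2 ≤ n ^ 3 := pow_le_pow_right₀ hn' (by norm_num)
      have h4 : (0 : ℝ) ≤ n ^ 3 := by positivity
      linarith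
    simp [hall]
  obtain ⟨hq, ε, hε, hεL, hεb⟩ := phase_parameters hP.one_le hδ₀ hδ₁ ht hB
  set B := batch P.δ t with hBdef
  set q := B / (4 * n) with hqdef
  set η := ENNReal.ofReal (2 * Real.exp (-(4 * Real.log (8 * (t : ℝ) ^ 2 / P.δ)))) with hη
  -- A crude bound, so that the finite rectangle `I` contains every round of the earlier phases.
  -- Finiteness keeps the conditioning variable countably valued.
  set N := ∑ l ∈ Finset.range t, batch P.δ l + 1 with hN
  set I : Finset (ℕ × ℕ) := Finset.range t ×ˢ Finset.range N with hI
  set J : Finset (ℕ × ℕ) := {t} ×ˢ Finset.range (B + 1) with hJ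
  have hIJ : Disjoint I J := by
    rw [Finset.disjoint_left]
    intro a h1 h2
    rw [hI, Finset.mem_product, Finset.mem_range] at h1
    rw [hJ, Finset.mem_product, Finset.mem_singleton] at h2
    omega
  have hmemI : ∀ l < t, ∀ s ≤ batch P.δ l, (l, s) ∈ I := by
    intro l hl s hs
    rw [hI, Finset.mem_product, Finset.mem_range, Finset.mem_range]
    have := Finset.single_le_sum (f := fun l => batch P.δ l) (fun _ _ => Nat.zero_le _)
      (Finset.mem_range.2 hl)
    exact ⟨hl, by simp only [hN] at *; omega⟩
  have hmemJ : ∀ s ≤ B, (t, s) ∈ J := by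
    intro s hs
    rw [hJ, Finset.mem_product, Finset.mem_range]
    exact ⟨Finset.mem_singleton_self _, by simp only; omega⟩
  -- Condition on both players' earlier coins and the player's own coins of this phase. This fixes
  -- the averages and the matched rounds, leaving the opponent's coins of the phase random.
  have hcond : μ {ω | EnoughSamples P.δ t (C ω t) ∧ ¬ good ω} ≤ (2 * n) * η := by
    refine measure_le_of_fiber ?_ (h.indepFun_history hIJ) fun ω₀ => ?_
    · exact (measurable_pi_lambda _ fun i => (h.measurable_row _ _).prodMk (h.measurable_col _ _)).prodMk
        (measurable_pi_lambda _ fun j => h.measurable_row _ _)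
    by_cases hES₀ : EnoughSamples P.δ t (C ω₀ t)
    swap
    -- Whether there are enough samples is decided by the conditioning variable, so this fibre does
    -- not meet the event.
    · refine ⟨∅, by simp, ?_, by simp⟩
      rintro ω ⟨hES, -⟩ hU
      refine absurd ((EnoughSamples.congr fun s hs => ?_).1 hES) hES₀
      exact congrFun (Prod.ext_iff.1 hU).2 ⟨(t, s), hmemJ s hs⟩
    set z : Fin n → Fin n → ℝ := fun i => (1 - mixing t) • xb ω₀ + mixing t • P.p i with hz
    have hzm : ∀ i, z i ∈ P.X := fun i =>
      hP.convex (hxm ω₀) (hP.design.1 i) (by linarith [mixing_le_one ht]) (mixing_nonneg t) (by ring)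
    set s₁ : Fin n → Fin q → ℕ := fun i j => exploreRound B (C ω₀ t) i j with hs₁
    set s₀ : Fin n → Fin q → ℕ := fun i j => baseRound B (C ω₀ t) ((i : ℕ) * q + j) with hs₀
    have hs₁i : ∀ i, Function.Injective (s₁ i) := by
      intro i j k hjk
      exact Fin.ext (nth_Icc_injOn B (fun s => C ω₀ t s = (true, i)) (hES₀.lt_card_explore i j)
        (hES₀.lt_card_explore i k) hjk)
    have hs₀i : ∀ i, Function.Injective (s₀ i) := by
      intro i j k hjk
      have := nth_Icc_injOn B (fun s => (C ω₀ t s).1 = false) (hES₀.lt_card_base i j)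
        (hES₀.lt_card_base i k) hjk
      exact Fin.ext (Nat.add_left_cancel this)
    set D : (Fin n → ℝ) → (Fin q → ℕ) → Set Ω := fun x s =>
      {ω | q * ε ≤ |∑ j, payoff A x (perturbation Q.p (yb ω₀) (e t (s j) ω))
        - q * ∑ v, payoff A x (perturbation Q.p (yb ω₀) v) / (2 * m)|} with hD
    have hDμ : ∀ x ∈ P.X, ∀ s, Function.Injective s → μ (D x s) ≤ η := by
      intro x hx s hs
      have := measure_payoff_perturbation_le h hA hQ.design.1 (hym ω₀) hx t hs hε
      rw [hεL] at this
      exact this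
    have hDV : ∀ x s, (∀ j, s j ≤ B) → ∀ ω ω', (fun (j : J) => e j.1.1 j.1.2 ω)
        = (fun (j : J) => e j.1.1 j.1.2 ω') → ω ∈ D x s → ω' ∈ D x s := by
      intro x s hs ω ω' hV hω
      have : ∀ j, e t (s j) ω = e t (s j) ω' := fun j => congrFun hV ⟨(t, s j), hmemJ _ (hs j)⟩
      simp only [hD, Set.mem_ofPred_eq, this] at hω ⊢
      exact hω
    refine ⟨⋃ i, (D (z i) (s₁ i) ∪ D (xb ω₀) (s₀ i)), ?_, ?_, ?_⟩
    · intro ω ω' hV hω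
      rw [Set.mem_iUnion] at hω ⊢
      obtain ⟨i, hi⟩ := hω
      exact ⟨i, hi.imp (hDV _ _ (fun j => exploreRound_le _ _ _ _) _ _ hV)
        (hDV _ _ (fun j => baseRound_le _ _ _) _ _ hV)⟩
    · rintro ω ⟨hES, hbad⟩ hU
      have hcI : ∀ l < t, ∀ s ≤ batch P.δ l, C ω l s = C ω₀ l s ∧ E ω l s = E ω₀ l s :=
        fun l hl s hs => Prod.ext_iff.1 (congrFun (Prod.ext_iff.1 hU).1 ⟨(l, s), hmemI l hl s hs⟩)
      have hcJ : ∀ s ≤ B, C ω t s = C ω₀ t s :=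
        fun s hs => congrFun (Prod.ext_iff.1 hU).2 ⟨(t, s), hmemJ s hs⟩
      obtain ⟨hxe, hye⟩ := average_reward_congr P Q A hδ t (fun l hl s hs => (hcI l hl s hs).1)
        (fun l hl s hs => (hcI l hl s hs).2)
      change xb ω = xb ω₀ at hxe
      change yb ω = yb ω₀ at hye
      by_contra hcon
      simp only [Set.mem_iUnion, Set.mem_union, not_exists, not_or] at hcon
      refine hbad fun x hx => ?_
      rw [hθ]
      refine (estimate_error hP.one_le hP.design A ht (xb := xb ω)
        (ξ := fun s => perturbation Q.p (yb ω) (E ω t s)) (β := 2 * ε + 2 * mixing t)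
        (fun s => ?_) hES hq (fun i => ?_) hx).trans hεb
      · change reward P Q A (C ω) (E ω) t s = _
        rw [reward_eq]
        congr 1
        change Q.play (E ω) (-R ω) t s = _
        unfold Learner.play perturbation
        change (if (E ω t s).1 = true then (1 - mixing t) • yb ω + mixing t • Q.p (E ω t s).2
          else yb ω) = _
        split_ifs
        · module
        · simp
      · obtain ⟨h1, h2⟩ := hcon i
        simp only [hD, Set.mem_ofPred_eq, not_le] at h1 h2
        simp only [hxe, hye]
        rw [← hBdef, ← hqdef]
        simp only [exploreRound_congr hcJ, baseRound_congr hcJ]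
        change |∑ j : Fin q, (payoff A (z i) (perturbation Q.p (yb ω₀) (e t (s₁ i j) ω))
          - (1 - mixing t) * payoff A (xb ω₀) (perturbation Q.p (yb ω₀) (e t (s₀ i j) ω)))| ≤ _
        rw [Finset.sum_sub_distrib, ← Finset.mul_sum]
        -- The mean at the exploring strategy splits so that its main part cancels against the
        -- unperturbed rounds, leaving a bias of at most `2 λ_t`.
        have hmean : ∑ v, payoff A (z i) (perturbation Q.p (yb ω₀) v) / (2 * m)
            = (1 - mixing t) * ∑ v, payoff A (xb ω₀) (perturbation Q.p (yb ω₀) v) / (2 * m)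
              + mixing t * ∑ v, payoff A (P.p i) (perturbation Q.p (yb ω₀) v) / (2 * m) := by
          rw [Finset.mul_sum, Finset.mul_sum, ← Finset.sum_add_distrib]
          refine Finset.sum_congr rfl fun v _ => ?_
          rw [hz, payoff_combo_left]
          ring
        have hpm := abs_mean_payoff_perturbation_le hQ.one_le hA hQ.design.1 (hym ω₀)
          (hP.design.1 i)
        rw [hmean] at h1
        have hl0 := mixing_nonneg t
        have hl1 := mixing_le_one ht
        generalize ∑ v, payoff A (xb ω₀) (perturbation Q.p (yb ω₀) v) / (2 * m) = M₀ at *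
        generalize ∑ v, payoff A (P.p i) (perturbation Q.p (yb ω₀) v) / (2 * m) = M₁ at *
        generalize ∑ j, payoff A (z i) (perturbation Q.p (yb ω₀) (e t (s₁ i j) ω)) = S₁ at *
        generalize ∑ j, payoff A (xb ω₀) (perturbation Q.p (yb ω₀) (e t (s₀ i j) ω)) = S₀ at *
        have hq0 : (0 : ℝ) ≤ q := Nat.cast_nonneg _
        have e1 : S₁ - (1 - mixing t) * S₀
            = (S₁ - q * ((1 - mixing t) * M₀ + mixing t * M₁))
              - (1 - mixing t) * (S₀ - q * M₀) + q * (mixing t * M₁) := by ring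
        have a1 : |(1 - mixing t) * (S₀ - q * M₀)| ≤ q * ε := by
          rw [abs_mul, abs_of_nonneg (by linarith)]
          calc _ ≤ 1 * (q * ε) := by gcongr; linarith
            _ = _ := one_mul _
        have a2 : |q * (mixing t * M₁)| ≤ q * (mixing t * 2) := by
          rw [abs_mul, abs_mul, abs_of_nonneg hq0, abs_of_nonneg hl0]
          gcongr
        rw [e1]
        refine (abs_add_le _ _).trans ((add_le_add_left (abs_sub _ _) _).trans ?_)
        linarith
    · refine (measure_iUnion_fintype_le _ _).trans ?_
      calc _ ≤ ∑ _i : Fin n, (η + η) := Finset.sum_le_sum fun i _ => (measure_union_le _ _).trans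
            (add_le_add (hDμ _ (hzm i) _ (hs₁i i)) (hDμ _ (hxm ω₀) _ (hs₀i i)))
        _ = _ := by simp; ring
  have hsamp := measure_not_enoughSamples_le h hP.one_le hδ₀ hδ₁ ht hB
  have hsub : {ω | ¬ good ω} ⊆ {ω | ¬ EnoughSamples P.δ t (C ω t)}
      ∪ {ω | EnoughSamples P.δ t (C ω t) ∧ ¬ good ω} := by
    intro ω hω
    by_cases hES : EnoughSamples P.δ t (C ω t)
    · exact Or.inr ⟨hES, hω⟩
    · exact Or.inl hES
  -- There are `1 + n` sampling events and `2 n` deviation events, each of probability at most `2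
  -- exp (-4 L)`; in total `2 (1 + 3 n) ≤ 8 n` exponentials.
  calc μ {ω | ¬ good ω} ≤ (1 + n) * η + 2 * n * η :=
        (measure_mono hsub).trans ((measure_union_le _ _).trans (add_le_add hsamp hcond))
    _ = ENNReal.ofReal ((1 + 3 * n) * (2 * Real.exp (-(4 * Real.log (8 * (t : ℝ) ^ 2 / P.δ))))) := by
        rw [ENNReal.ofReal_mul (by positivity), ← hη, ENNReal.ofReal_add (by norm_num) (by positivity),
          ENNReal.ofReal_mul (by norm_num)]
        simp
        ring
    _ ≤ _ := by
        refine ENNReal.ofReal_le_ofReal ((le_trans ?_ (failure_probability_le hP.one_le hδ₀ hδ₁ ht hB)))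
        have := Real.exp_pos (-(4 * Real.log (8 * (t : ℝ) ^ 2 / P.δ)))
        nlinarith

end Concentration

/-! ### Union bound over phases and players -/

theorem tsum_failure_le {δ : ℝ} (hδ₀ : 0 < δ) :
    ∑' t : ℕ, ENNReal.ofReal (δ / (4 * ((t + 1 : ℕ) : ℝ) ^ 2)) ≤ ENNReal.ofReal (δ / 2) := by
  have hs : HasSum (fun t : ℕ => 1 / ((t + 1 : ℕ) : ℝ) ^ 2) (Real.pi ^ 2 / 6) := by
    have := (hasSum_nat_add_iff' (f := fun t : ℕ => 1 / (t : ℝ) ^ 2) 1).2 hasSum_zeta_two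
    simpa using this
  have hs' : HasSum (fun t : ℕ => δ / (4 * ((t + 1 : ℕ) : ℝ) ^ 2)) (δ / 4 * (Real.pi ^ 2 / 6)) := by
    have heq : (fun t : ℕ => δ / (4 * ((t + 1 : ℕ) : ℝ) ^ 2))
        = fun t : ℕ => δ / 4 * (1 / ((t + 1 : ℕ) : ℝ) ^ 2) := by
      funext t
      field_simp
    rw [heq]
    exact hs.mul_left (δ / 4)
  rw [← ENNReal.ofReal_tsum_of_nonneg (fun t => by positivity) hs'.summable, hs'.tsum_eq]
  refine ENNReal.ofReal_le_ofReal ?_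
  -- The sum is `δ π² / 24`, so `π² ≤ 12` leaves `δ/2` for each player.
  have : Real.pi ^ 2 ≤ 12 := by nlinarith [Real.pi_lt_d2, Real.pi_pos]
  nlinarith

end BanditGame

end

theorem mainTheorem1 :
    ∃ C : ℝ, 0 < C ∧
      ∀ (n m : ℕ) (_hn : 1 ≤ n) (_hm : 1 ≤ m)
        (X : Set (Fin n → ℝ)) (Y : Set (Fin m → ℝ)) (A : Matrix (Fin n) (Fin m) ℝ)
        (_hXc : IsCompact X) (_hXconv : Convex ℝ X) (_hXspan : Submodule.span ℝ X = ⊤)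
        (_hYc : IsCompact Y) (_hYconv : Convex ℝ Y) (_hYspan : Submodule.span ℝ Y = ⊤)
        (_hA : ∀ x ∈ X, ∀ y ∈ Y, BanditGame.payoff A x y ∈ Set.Icc (-1 : ℝ) 1)
        (p : Fin n → Fin n → ℝ) (_hp : BanditGame.IsExplorationDesign X p)
        (q : Fin m → Fin m → ℝ) (_hq : BanditGame.IsExplorationDesign Y q)
        (H : Matrix (Fin n) (Fin n) ℝ) (_hH : BanditGame.IsEllipsoidApprox X H)
        (G : Matrix (Fin m) (Fin m) ℝ) (_hG : BanditGame.IsEllipsoidApprox Y G)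
        (δ : ℝ) (_hδ₀ : 0 < δ) (_hδ₁ : δ ≤ 1 / 2)
        (Ω : Type*) [MeasurableSpace Ω] (μ : Measure Ω) [IsProbabilityMeasure μ]
        (c : ℕ → ℕ → Ω → BanditGame.Coin n) (e : ℕ → ℕ → Ω → BanditGame.Coin m)
        (_hce : BanditGame.FairCoins μ c e),
        ENNReal.ofReal (1 - δ) ≤
          μ {ω | ∀ k : ℕ, 1 ≤ k →
            BanditGame.IsApproxNash X Y A (BanditGame.rate C n m δ k)
              (BanditGame.rowIterate ⟨X, p, H, 1 / 6, δ⟩ ⟨Y, q, G, 1 / 6, δ⟩ A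
                (fun t s => c t s ω) (fun t s => e t s ω) k)
              (BanditGame.colIterate ⟨X, p, H, 1 / 6, δ⟩ ⟨Y, q, G, 1 / 6, δ⟩ A
                (fun t s => c t s ω) (fun t s => e t s ω) k)} := by
  -- The `6` comes from `phase_rate_le`; the other factor is the constant of `isApproxNash_of_error`
  -- with `K = 2500`.
  refine ⟨6 * (43 + 8 * 2500), by norm_num, ?_⟩
  intro n m hn hm X Y A hXc hX _ hYc hY _ hA p hp q hq H hH G hG δ hδ₀ hδ₁ Ω _ μ _ c e hce
  set P : BanditGame.Learner n := ⟨X, p, H, 1 / 6, δ⟩ with hPdef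
  set Q : BanditGame.Learner m := ⟨Y, q, G, 1 / 6, δ⟩ with hQdef
  have hP : P.Admissible := ⟨hn, hXc, hX, hp, hH, rfl⟩
  have hQ : Q.Admissible := ⟨hm, hYc, hY, hq, hG, rfl⟩
  have hA' : ∀ y ∈ Y, ∀ x ∈ X, BanditGame.payoff (-Aᵀ) y x ∈ Set.Icc (-1 : ℝ) 1 := by
    intro y hy x hx
    rw [BanditGame.payoff_neg_transpose]
    have := hA x hx y hy
    rw [Set.mem_Icc] at this ⊢
    constructor <;> linarith
  set C : Ω → ℕ → ℕ → BanditGame.Coin n := fun ω t s => c t s ω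
  set E : Ω → ℕ → ℕ → BanditGame.Coin m := fun ω t s => e t s ω
  set R : Ω → ℕ → ℕ → ℝ := fun ω => BanditGame.reward P Q A (C ω) (E ω) with hR
  set badP : ℕ → Set Ω := fun t => {ω | ¬ ∀ z ∈ X, |z ⬝ᵥ (P.thetaHat (C ω) (R ω) t
    - A *ᵥ Q.average (E ω) (-R ω) t)| ≤ Real.sqrt (2500 * n ^ 3 / t ^ 3)} with hbadP
  set badQ : ℕ → Set Ω := fun t => {ω | ¬ ∀ w ∈ Y, |w ⬝ᵥ (Q.thetaHat (E ω) (-R ω) t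
    - (-Aᵀ) *ᵥ P.average (C ω) (R ω) t)| ≤ Real.sqrt (2500 * m ^ 3 / t ^ 3)} with hbadQ
  have hPμ : ∀ t, 1 ≤ t → μ (badP t) ≤ ENNReal.ofReal (δ / (4 * t ^ 2)) := fun t ht =>
    BanditGame.measure_error_le hce hP hQ hA rfl hδ₀ hδ₁ ht
  have hQμ : ∀ t, 1 ≤ t → μ (badQ t) ≤ ENNReal.ofReal (δ / (4 * t ^ 2)) := by
    intro t ht
    have := BanditGame.measure_error_le (A := -Aᵀ) hce.swap hQ hP hA' rfl hδ₀ hδ₁ ht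
    simp only [BanditGame.reward_swap, neg_neg] at this
    exact this
  set good : Set Ω := {ω | ∀ k : ℕ, 1 ≤ k → BanditGame.IsApproxNash X Y A
    (BanditGame.rate (6 * (43 + 8 * 2500)) n m δ k) (BanditGame.rowIterate P Q A (C ω) (E ω) k)
    (BanditGame.colIterate P Q A (C ω) (E ω) k)} with hgood
  -- Phases are numbered from `1`, hence the shift. Off these events the estimates of all phases are
  -- accurate, and all rounds are handled at once.
  have hsub : goodᶜ ⊆ ⋃ t : ℕ, (badP (t + 1) ∪ badQ (t + 1)) := by
    intro ω hω
    by_contra hcon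
    simp only [Set.mem_iUnion, Set.mem_union, not_exists, not_or] at hcon
    refine hω fun k hk => ?_
    have hT := BanditGame.one_le_phaseOf hδ₀ hδ₁ hk
    have hrate := BanditGame.phase_rate_le hδ₀ hδ₁ hk
    refine (BanditGame.isApproxNash_of_error (P := P) (Q := Q) hP hQ hA (C ω) (E ω) (R ω) (-R ω)
      (K := 2500) (by norm_num) ?_ ?_ hT (BanditGame.roundOf δ k)).mono ?_
    · intro t ht
      have := (hcon (t - 1)).1
      rw [Nat.sub_add_cancel ht] at this
      exact not_not.1 this
    · intro t ht
      have := (hcon (t - 1)).2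
      rw [Nat.sub_add_cancel ht] at this
      exact not_not.1 this
    · unfold BanditGame.rate
      rw [mul_div_assoc]
      calc _ ≤ (43 + 8 * 2500) * ((n : ℝ) ^ 3 + m ^ 3) * (6 * Real.log ((k : ℝ) + 1)
            * Real.log (8 * (k : ℝ) ^ 2 / δ) ^ (1 / 4 : ℝ) * (k : ℝ) ^ (-(1 / 4) : ℝ)) := by gcongr
        _ = _ := by ring
  have hbad : μ goodᶜ ≤ ENNReal.ofReal δ := by
    calc μ goodᶜ ≤ ∑' t : ℕ, μ (badP (t + 1) ∪ badQ (t + 1)) :=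
          (measure_mono hsub).trans (measure_iUnion_le _)
      _ ≤ ∑' t : ℕ, (ENNReal.ofReal (δ / (4 * ((t + 1 : ℕ) : ℝ) ^ 2))
            + ENNReal.ofReal (δ / (4 * ((t + 1 : ℕ) : ℝ) ^ 2))) :=
          ENNReal.tsum_le_tsum fun t => (measure_union_le _ _).trans
            (add_le_add (hPμ _ (by omega)) (hQμ _ (by omega)))
      _ ≤ ENNReal.ofReal (δ / 2) + ENNReal.ofReal (δ / 2) := by
          rw [ENNReal.tsum_add]
          exact add_le_add (BanditGame.tsum_failure_le hδ₀) (BanditGame.tsum_failure_le hδ₀)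
      _ = _ := by rw [← ENNReal.ofReal_add (by positivity) (by positivity), add_halves]
  rw [ENNReal.ofReal_sub _ hδ₀.le, ENNReal.ofReal_one, tsub_le_iff_right]
  -- Subadditivity suffices here, so measurability of `good` is not required.
  calc (1 : ENNReal) = μ (good ∪ goodᶜ) := by rw [Set.union_compl_self, measure_univ]
    _ ≤ μ good + μ goodᶜ := measure_union_le _ _
    _ ≤ _ := by gcongr
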